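/- Let $q$ be a prime power and let $\ell_\infty$ be a line of $\mathrm{PG}(2,q^3)$. An order-$q$-subplane (respectively order-$q$-subline) of $\mathrm{PG}(2,q^3)$ is an image under $\mathrm{PGL}(3,q^3)$ of the canonical $\mathrm{PG}(2,q)$ (respectively $\mathrm{PG}(1,q)$); the lines of an order-$q$-subplane $\pi$ are the lines of $\mathrm{PG}(2,q^3)$ that join two distinct points of $\pi$. Call $\pi$ exterior if it has no point on $\ell_\infty$; its exterior splash is then the set of points of $\ell_\infty$ that lie on a line of $\pi$. Let $\pi$ be an exterior order-$q$-subplane with exterior splash $\mathbb S$. - A $\pi$-pencil-subline of $\mathbb S$ is the set of points in which the lines of $\pi$ through some point $P\in\pi$ meet $\ell_\infty$. - A dual conic of $\pi=g(\mathrm{PG}(2,q))$, $g\in\mathrm{PGL}(3,q^3)$, is the image under $g$ of the set of lines $[u]$ of $\mathrm{PG}(2,q)$ with $f(u)=0$, for a nonzero ternary quadratic form $f$ over $\mathbb F_q$ in the line coordinates; its extension is the image under $g$ of the set of lines $[u]$ of $\mathrm{PG}(2,q^3)$ with $f(u)=0$. It is special if its extension contains every line fixed by the group $\mathrm{PGL}(3,q^3)_{\pi,\ell_\infty}$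 of all homographies that stabilise $\pi$ and $\ell_\infty$ (these fixed lines are $\ell_\infty$ and its two conjugates with respect to $\pi$; a special dual conic is necessarily irreducible). - A $\pi$-dual-conic-subline of $\mathbb S$ is the set of points in which the lines of some special dual conic of $\pi$ meet $\ell_\infty$. **Theorem.** Let $\pi_1\neq\pi_2$ be two exterior order-$q$-subplanes of $\mathrm{PG}(2,q^3)$ that have a common exterior splash $\mathbb S$ on $\ell_\infty$ and that both contain a common order-$q$-subline $b$. Then the $\pi_1$-pencil-sublines of $\mathbb S$ are exactly the $\pi_2$-dual-conic-sublines of $\mathbb S$, and the $\pi_1$-dual-conic-sublines of $\mathbb S$ are exactly the $\pi_2$-pencil-sublines of $\mathbb S$. -/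

import Mathlib

open scoped LinearAlgebra.Projectivization

namespace ExteriorSplash

/-- Points of the Desarguesian plane `PG(2, F)`, in homogeneous coordinates. -/
abbrev Point (F : Type*) [Field F] := ℙ F (Fin 3 → F)

/-- Lines of `PG(2, F)`, in homogeneous line coordinates: `[a, b, c]` is the line
`a x + b y + c z = 0`. -/
abbrev Line (F : Type*) [Field F] := ℙ F (Fin 3 → F)

/-- The linear automorphisms of `F³`; they induce the homographies of `PG(2, F)`, i.e. the
elements of `PGL(3, F)`, through the action on points `g • P`. -/
abbrev Homography (F : Type*) [Field F] := (Fin 3 → F) ≃ₗ[F] (Fin 3 → F)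

section Plane

variable {L : Type*} [Field L]

/-- The set of points of `PG(2, L)` on the line `m`. -/
def pointsOn (m : Line L) : Set (Point L) := {P | P.orthogonal m}

/-- The image of a set of points under a homography. -/
def image (g : Homography L) (X : Set (Point L)) : Set (Point L) := (fun P => g • P) '' X

/-- The homography `g` maps the line `m` onto the line `m'`. -/
def MapsLine (g : Homography L) (m m' : Line L) : Prop :=
  image g (pointsOn m) = pointsOn m'

/-- The (extended) lines of a subplane `π`: the lines of `PG(2, L)` that join two distinct
points of `π`. -/
def linesOf (π : Set (Point L)) : Set (Line L) :=
  {m | ∃ P ∈ π, ∃ Q ∈ π, P ≠ Q ∧ P ∈ pointsOn m ∧ Q ∈ pointsOn m}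

/-- `π` is exterior to the line `l`: no point of `π` lies on `l`. -/
def IsExterior (π : Set (Point L)) (l : Line L) : Prop := Disjoint π (pointsOn l)

/-- The points in which the line `l` is met by the lines of the family `D`. -/
def trace (l : Line L) (D : Set (Line L)) : Set (Point L) :=
  {X | X ∈ pointsOn l ∧ ∃ m ∈ D, X ∈ pointsOn m}

/-- The splash of `π` on `l`: the points of `l` that lie on an extended line of `π`. -/
def splash (π : Set (Point L)) (l : Line L) : Set (Point L) := trace l (linesOf π)

/-- The pencil sublines of the splash of `π` on `l`: for a point `P` of `π`, the set of points
in which the lines of `π` through `P` meet `l`. -/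
def pencilSublines (π : Set (Point L)) (l : Line L) : Set (Set (Point L)) :=
  {c | ∃ P ∈ π, c = trace l {m | m ∈ linesOf π ∧ P ∈ pointsOn m}}

/-- The group `PGL(3, L)_{π, l}` of homographies that stabilise `π` and `l`. -/
def stabilizer (π : Set (Point L)) (l : Line L) : Set (Homography L) :=
  {g | image g π = π ∧ MapsLine g l l}

/-- The lines fixed by every homography that stabilises `π` and `l`.  For an order-`q`-subplane
`π` exterior to `l` these are `l` and its two conjugates with respect to `π`. -/
def fixedLines (π : Set (Point L)) (l : Line L) : Set (Line L) :=
  {m | ∀ g ∈ stabilizer π l, MapsLine g m m}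

end Plane

section Subgeometry

variable (K : Type*) [Field K] {L : Type*} [Field L] [Algebra K L]

/-- The canonical subplane `PG(2, K)` of `PG(2, L)`: the points that have homogeneous
coordinates in `K`. -/
def standardSubplane : Set (Point L) :=
  {P | ∃ x : Fin 3 → K, ∃ h : (fun i => algebraMap K L (x i)) ≠ 0,
    P = Projectivization.mk L (fun i => algebraMap K L (x i)) h}

/-- The canonical subline `PG(1, K)`, on the line `z = 0` of `PG(2, L)`. -/
def standardSubline : Set (Point L) :=
  {P | ∃ x : Fin 3 → K, x 2 = 0 ∧ ∃ h : (fun i => algebraMap K L (x i)) ≠ 0,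
    P = Projectivization.mk L (fun i => algebraMap K L (x i)) h}

/-- An order-`q`-subplane of `PG(2, L)`, where `K` is the subfield of order `q`: an image of
`PG(2, K)` under `PGL(3, L)`. -/
def IsSubplane (π : Set (Point L)) : Prop :=
  ∃ g : Homography L, π = image g (standardSubplane K)

/-- An order-`q`-subline of `PG(2, L)`: an image of `PG(1, K)` under `PGL(3, L)`. -/
def IsSubline (b : Set (Point L)) : Prop :=
  ∃ g : Homography L, b = image g (standardSubline K)

variable {K}

/-- A ternary quadratic form `f` over `K` in the line coordinates defines a dual conic of
`PG(2, K)`, whose extension consists of the lines `[u]` of `PG(2, L)` with `f u = 0`.  This is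
the image of that extension under the homography `g`; for `π = g (PG(2, K))` it is the extension
to `PG(2, L)` of a dual conic of `π`, and the lines of the dual conic itself are those that
are lines of `π`. -/
def extendedDualConic (f : MvPolynomial (Fin 3) K) (g : Homography L) : Set (Line L) :=
  {m' | ∃ m : Line L, MvPolynomial.aeval m.rep f = 0 ∧ MapsLine g m m'}

variable (K)

/-- `D` is the extension to `PG(2, L)` of a dual conic of the order-`q`-subplane `π`. -/
def IsExtendedDualConic (π : Set (Point L)) (D : Set (Line L)) : Prop :=
  ∃ (g : Homography L) (f : MvPolynomial (Fin 3) K),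
    π = image g (standardSubplane K) ∧ f.IsHomogeneous 2 ∧ f ≠ 0 ∧ D = extendedDualConic f g

/-- The extension of a `(π, l)`-special dual conic: one that contains all fixed lines of
`PGL(3, L)_{π, l}`.  (Such a dual conic is automatically irreducible.) -/
def IsExtendedSpecialDualConic (π : Set (Point L)) (l : Line L) (D : Set (Line L)) : Prop :=
  IsExtendedDualConic K π D ∧ fixedLines π l ⊆ D

/-- The dual-conic sublines of the splash of `π` on `l`: for a `(π, l)`-special dual conic, the
set of points in which its lines (they are lines of `π`) meet `l`. -/
def dualConicSublines (π : Set (Point L)) (l : Line L) : Set (Set (Point L)) :=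
  {c | ∃ D, IsExtendedSpecialDualConic K π l D ∧ c = trace l {m | m ∈ linesOf π ∧ m ∈ D}}

end Subgeometry

end ExteriorSplash

/-! Let `σ` be the `q`-Frobenius of the cubic extension `L` of `K`, and write `Tr` and `N` for the
sums and products over `1, σ, σ²`. In a suitable frame an exterior subplane is the set of points
`(z, σ z, σ² z)` and the exterior line is `x = 0` (`exists_isModel`). Its lines are then the `(u, σ
u, σ² u)`, its fixed lines are the sides of the coordinate triangle, the pencil at `z` is `Tr (z u)
= 0`, and the special dual conics are `Tr (A σ(u) σ²(u)) = 0` with `A ≠ 0`. By Hilbert 90 the splash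
is the set of points `(0, 1, -n)` with `N n = 1`.

Take such frames for both subplanes. The transition between them acts on the exterior line by an
invertible 2 × 2 matrix preserving the splash. Since `σ n = n ^ q`, this is a polynomial identity of
degree below `q² + q + 1` in `n`, and there are `q² + q + 1` elements of norm one; comparing
coefficients forces the matrix to be diagonal or antidiagonal (`diagonal_or_antidiagonal`).

In the diagonal case the `q + 1` points of the common subline force the two subplanes to coincide
(`eq_of_common_subline`), which is excluded. In the antidiagonal case, for a suitable constant `v`,
the substitution `u ↦ v / u` carries lines of one subplane to lines of the other with the same trace
on the exterior line. Multiplying by a norm turns `Tr (z u) = 0` into `Tr (v z σ(w) σ²(w)) = 0` for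
`w = v / u`, so pencils become special dual conics (`exists_traceCurve_eq`). -/

namespace ExteriorSplash

/-! ### Arithmetic of the cubic extension: independence, Hilbert 90, polynomial arguments. -/

section CubicFrobenius

variable {K L : Type*} [Field K] [Field L] [Algebra K L]

/-- `σ` is the Frobenius automorphism of a cubic extension `L` of the finite field `K`. -/
structure IsCubicFrobenius (σ : L →ₐ[K] L) : Prop where
  apply_eq_pow : ∀ x, σ x = x ^ Nat.card K
  cube : ∀ x, σ (σ (σ x)) = x
  fixed : ∀ x, σ x = x → ∃ k, algebraMap K L k = x
  exists_ne : ∃ c, σ c ≠ c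

theorem exists_isCubicFrobenius [Finite K] (h : Module.finrank K L = 3) :
    ∃ σ : L →ₐ[K] L, IsCubicFrobenius σ := by
  classical
  have : Fintype K := Fintype.ofFinite K
  have : Module.Finite K L := Module.finite_of_finrank_pos (by omega)
  have : Finite L := Module.finite_of_finite K
  have ho := FiniteField.orderOf_frobeniusAlgHom K L
  rw [h] at ho
  have hfix : ∀ x : L, FiniteField.frobeniusAlgHom K L x = x → ∃ k, algebraMap K L k = x := by
    intro x hx
    have hp : (Polynomial.X ^ Fintype.card K - Polynomial.X : Polynomial L) ≠ 0 :=
      FiniteField.X_pow_card_sub_X_ne_zero L Fintype.one_lt_card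
    by_contra hc
    push Not at hc
    -- A fixed element outside `K` would be a root of `X ^ q - X` in addition to the `q` elements of
    -- `K`.
    let f : Option K → L := fun o => o.elim x (algebraMap K L)
    have hf : Function.Injective f := by
      rintro (_ | a) (_ | b) hab
      · rfl
      · exact absurd hab.symm (hc b)
      · exact absurd hab (hc a)
      · exact congrArg some ((algebraMap K L).injective hab)
    refine hp (Polynomial.eq_zero_of_natDegree_lt_card_of_eval_eq_zero _ hf ?_ ?_)
    · rintro (_ | a)
      · simpa [f, sub_eq_zero] using hx
      · simp [f, ← map_pow, FiniteField.pow_card]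
    · rw [FiniteField.X_pow_card_sub_X_natDegree_eq L Fintype.one_lt_card]
      simp
  refine ⟨FiniteField.frobeniusAlgHom K L, ⟨fun x => ?_, fun x => ?_, hfix, ?_⟩⟩
  · simp [Nat.card_eq_fintype_card]
  · have := pow_orderOf_eq_one (FiniteField.frobeniusAlgHom K L)
    rw [ho] at this
    have := DFunLike.congr_fun this x
    simpa only [AlgHom.coe_pow, Function.iterate_succ, Function.iterate_zero, Function.comp_apply,
      id, AlgHom.one_apply] using this
  · by_contra hc
    push Not at hc
    have : FiniteField.frobeniusAlgHom K L = 1 := AlgHom.ext fun x => by simpa using hc x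
    rw [this, orderOf_one] at ho
    omega

namespace IsCubicFrobenius

variable {σ : L →ₐ[K] L}

theorem ne_zero (σ : L →ₐ[K] L) {x : L} (hx : x ≠ 0) : σ x ≠ 0 := by simpa using hx

theorem exists_generic (hσ : IsCubicFrobenius σ) :
    ∃ c, c ≠ 0 ∧ σ c ≠ c ∧ σ (σ c) ≠ c ∧ σ (σ c) ≠ σ c := by
  obtain ⟨c, hc⟩ := hσ.exists_ne
  refine ⟨c, ?_, hc, fun h => hc ?_, fun h => hc (σ.injective h)⟩
  · rintro rfl
    simp at hc
  · rw [← h, hσ.cube, h]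

/-- The automorphisms `1, σ, σ²` are linearly independent over `L`. -/
theorem eq_zero_of_forall (hσ : IsCubicFrobenius σ) {a b c : L}
    (h : ∀ z, a * z + b * σ z + c * σ (σ z) = 0) : a = 0 ∧ b = 0 ∧ c = 0 := by
  -- Testing at `1, t, t²` gives a Vandermonde system with the distinct nodes `t, σ t, σ² t`.
  obtain ⟨t, -, h1, h2, h3⟩ := hσ.exists_generic
  have e0 := h 1
  have e1 := h t
  have e2 := h (t * t)
  simp only [map_mul, map_one] at e0 e1 e2
  have hc : c = 0 := by
    have : c * ((σ (σ t) - t) * (σ (σ t) - σ t)) = 0 := by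
      linear_combination e2 - (t + σ t) * e1 + t * σ t * e0
    simpa [sub_ne_zero.2 h2, sub_ne_zero.2 h3] using this
  subst hc
  have hb : b = 0 := by
    have : b * (σ t - t) = 0 := by linear_combination e1 - t * e0
    simpa [sub_ne_zero.2 h1] using this
  subst hb
  exact ⟨by simpa using e0, rfl, rfl⟩

/-- Hilbert 90 for a cubic extension of finite fields. -/
theorem exists_of_norm_eq_one (hσ : IsCubicFrobenius σ) {n : L} (hn : n * σ n * σ (σ n) = 1) :
    ∃ u, u ≠ 0 ∧ n * σ (σ u) = σ u := by
  obtain ⟨c, hc⟩ : ∃ c, 1 * c + n * σ c + n * σ n * σ (σ c) ≠ 0 := by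
    by_contra! h
    exact one_ne_zero (hσ.eq_zero_of_forall h).1
  -- The resolvent `θ = c + n σ c + n σ n σ² c` satisfies `n σ θ = θ`; take `u = σ² θ`, so that `σ u
  -- = θ`.
  refine ⟨σ (σ (1 * c + n * σ c + n * σ n * σ (σ c))), ne_zero σ (ne_zero σ hc), ?_⟩
  simp only [hσ.cube, map_add, map_mul, map_one]
  linear_combination c * hn

variable [Finite K]

theorem two_le_card (K : Type*) [Field K] [Finite K] : 2 ≤ Nat.card K :=
  Finite.one_lt_card

theorem finite (hL : Module.finrank K L = 3) : Finite L :=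
  have : Module.Finite K L := Module.finite_of_finrank_pos (by omega)
  Module.finite_of_finite K

/-- The elements of norm one are the `(q² + q + 1)`-st roots of unity, and there are
`q² + q + 1` of them. -/
theorem poly_eq_zero_of_norm_one (hL : Module.finrank K L = 3) (hσ : IsCubicFrobenius σ)
    {p : Polynomial L}
    (hdeg : p.natDegree < Nat.card K ^ 2 + Nat.card K + 1)
    (h : ∀ n, n * σ n * σ (σ n) = 1 → p.eval n = 0) : p = 0 := by
  have : Finite L := finite (K := K) hL
  have : Module.Finite K L := Module.finite_of_finrank_pos (by omega)
  have hcard : Nat.card L = Nat.card K ^ 3 := hL ▸ Module.natCard_eq_pow_finrank (K := K) (V := L)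
  set q := Nat.card K with hq
  have hq2 : 2 ≤ q := two_le_card K
  obtain ⟨g, hg⟩ := IsCyclic.exists_generator (α := Lˣ)
  have hord : orderOf g = Nat.card L - 1 := by
    rw [orderOf_eq_card_of_forall_mem_zpowers hg, Nat.card_units]
  have hfac : Nat.card L - 1 = (q - 1) * (q ^ 2 + q + 1) := by
    rw [hcard]
    obtain ⟨m, hm⟩ := Nat.exists_eq_add_of_le hq2
    rw [hm]
    have : (2 + m) ^ 3 = (2 + m - 1) * ((2 + m) ^ 2 + (2 + m) + 1) + 1 := by
      rw [show 2 + m - 1 = 1 + m by omega]; ring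
    omega
  have hprim : IsPrimitiveRoot g ((q - 1) * (q ^ 2 + q + 1)) := by
    rw [← hfac, ← hord]; exact IsPrimitiveRoot.orderOf g
  -- As `q³ - 1 = (q - 1)(q² + q + 1)`, this power of a generator of `Lˣ` has order `q² + q + 1`;
  -- the norm is the power map with exponent `1 + q + q²`, so all powers of it have norm one.
  have hζ : IsPrimitiveRoot (g ^ (q - 1)) (q ^ 2 + q + 1) :=
    hprim.pow (Nat.mul_pos (by omega) (by positivity)) rfl
  have hζ' : IsPrimitiveRoot ((g ^ (q - 1) : Lˣ) : L) (q ^ 2 + q + 1) :=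
    IsPrimitiveRoot.coe_units_iff.2 hζ
  set ζ : L := ((g ^ (q - 1) : Lˣ) : L)
  have hinj : Function.Injective (fun i : Fin (q ^ 2 + q + 1) => ζ ^ (i : ℕ)) := fun i j hij =>
    Fin.ext (hζ'.pow_inj i.2 j.2 hij)
  refine Polynomial.eq_zero_of_natDegree_lt_card_of_eval_eq_zero p hinj (fun i => h _ ?_)
    (by simpa using hdeg)
  rw [map_pow, map_pow, ← mul_pow, ← mul_pow, hσ.apply_eq_pow ζ, map_pow, hσ.apply_eq_pow ζ,
    ← pow_mul, ← pow_succ', ← pow_add, ← hq,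
    show q + 1 + q * q = q ^ 2 + q + 1 by ring, hζ'.pow_eq_one, one_pow]

open Polynomial in
/-- A projectivity of the line that maps the set of elements of norm `-1` into itself is
diagonal or antidiagonal. -/
theorem diagonal_or_antidiagonal (hL : Module.finrank K L = 3) (hσ : IsCubicFrobenius σ)
    {α β γ δ : L} (hdet : α * δ - β * γ ≠ 0)
    (h : ∀ n, n * σ n * σ (σ n) = 1 →
      (α - β * n) * σ (α - β * n) * σ (σ (α - β * n)) +
        (γ - δ * n) * σ (γ - δ * n) * σ (σ (γ - δ * n)) = 0) :
    (β = 0 ∧ γ = 0) ∨ (α = 0 ∧ δ = 0) := by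
  have hq2 : 2 ≤ Nat.card K := two_le_card K
  obtain ⟨q, hq⟩ : ∃ q, q = Nat.card K := ⟨_, rfl⟩
  rw [← hq] at hq2
  have hqq : 2 * q ≤ q ^ 2 := by nlinarith
  obtain ⟨s, hs⟩ : ∃ s, s = q ^ 2 := ⟨_, rfl⟩
  rw [← hs] at hqq
  -- The hypothesis expanded in `n`, `n ^ q = σ n` and `n ^ (q²) = σ² n`. The term of degree `1 + q
  -- + q²` is `N n = 1` times a constant, and is absorbed into `k0`.
  let k0 := α * σ α * σ (σ α) + γ * σ γ * σ (σ γ) - β * σ β * σ (σ β) - δ * σ δ * σ (σ δ)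
  let k1 := -(β * σ α * σ (σ α) + δ * σ γ * σ (σ γ))
  let k2 := -(α * σ β * σ (σ α) + γ * σ δ * σ (σ γ))
  let k3 := -(α * σ α * σ (σ β) + γ * σ γ * σ (σ δ))
  let k4 := β * σ β * σ (σ α) + δ * σ δ * σ (σ γ)
  let k5 := β * σ α * σ (σ β) + δ * σ γ * σ (σ δ)
  let k6 := α * σ β * σ (σ β) + γ * σ δ * σ (σ δ)
  let p : L[X] := C k0 + C k1 * X ^ 1 + C k2 * X ^ q + C k3 * X ^ s + C k4 * X ^ (1 + q) +
    C k5 * X ^ (1 + s) + C k6 * X ^ (q + s)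
  have hp : p = 0 := by
    refine poly_eq_zero_of_norm_one hL hσ (p := p) ?_ fun n hn => ?_
    · rw [← hq, ← hs]
      refine Nat.lt_succ_of_le (natDegree_le_iff_coeff_eq_zero.2 fun N hN => ?_)
      simp only [p, coeff_add, coeff_C_mul, coeff_X_pow, coeff_C]
      simp [show N ≠ 0 by omega, show N ≠ 1 by omega, show N ≠ q by omega, show N ≠ s by omega,
        show N ≠ 1 + q by omega, show N ≠ 1 + s by omega, show N ≠ q + s by omega]
    · have e1 : n ^ q = σ n := by rw [hσ.apply_eq_pow, hq]
      have e2 : n ^ s = σ (σ n) := by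
        rw [hσ.apply_eq_pow (σ n), hσ.apply_eq_pow n, ← hq, ← pow_mul, hs, sq]
      have := h n hn
      simp only [map_sub, map_mul] at this
      simp only [p, eval_add, eval_mul, eval_C, eval_pow, eval_X, pow_add, e1, e2, k0, k1, k2, k3,
        k4, k5, k6]
      linear_combination this + (β * σ β * σ (σ β) + δ * σ δ * σ (σ δ)) * hn
  have h1 : k1 = 0 := by
    have := congrArg (coeff · 1) hp
    simp only [p, coeff_add, coeff_C_mul, coeff_X_pow, coeff_C, coeff_zero] at this
    simpa [show 1 ≠ q by omega, show 1 ≠ s by omega, show q ≠ 0 by omega, show s ≠ 0 by omega,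
        show 1 ≠ q + s by omega] using this
  have h6 : k6 = 0 := by
    have := congrArg (coeff · (q + s)) hp
    simp only [p, coeff_add, coeff_C_mul, coeff_X_pow, coeff_C, coeff_zero] at this
    simpa [show q + s ≠ 1 by omega, show s ≠ 0 by omega, show q ≠ 0 by omega,
      show q + s ≠ 1 + q by omega, show q + s ≠ 1 + s by omega, show q ≠ 1 by omega] using this
  clear_value p
  simp only [k1, k6, neg_eq_zero] at h1 h6
  by_cases hα : α = 0
  · subst hα
    have hβ : β ≠ 0 := by rintro rfl; simp at hdet
    have hγ : γ ≠ 0 := by rintro rfl; simp at hdet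
    right
    simpa [hγ] using h1
  by_cases hβ : β = 0
  · subst hβ
    have hδ : δ ≠ 0 := by rintro rfl; simp at hdet
    left
    simpa [hδ] using h1
  exfalso
  have hγ : γ ≠ 0 := by rintro rfl; simp [hα, hβ] at h1
  have hδ : δ ≠ 0 := by rintro rfl; simp [hα, hβ] at h1
  have h1' := congrArg σ h1
  have h1'' := congrArg (fun x => σ (σ x)) h1
  have h6' := congrArg σ h6
  simp only [map_add, map_mul, hσ.cube, map_zero] at h1' h1'' h6'
  have n := fun {x : L} (hx : x ≠ 0) => ne_zero σ hx
  apply hdet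
  have hα1 := n hα
  have hα2 := n hα1
  have hβ1 := n hβ
  have hβ2 := n hβ1
  have hγ1 := n hγ
  have hγ2 := n hγ1
  have hδ1 := n hδ
  have hδ2 := n hδ1
  generalize σ (σ α) = α2 at *
  generalize σ (σ β) = β2 at *
  generalize σ (σ γ) = γ2 at *
  generalize σ (σ δ) = δ2 at *
  generalize σ α = α1 at *
  generalize σ β = β1 at *
  generalize σ γ = γ1 at *
  generalize σ δ = δ1 at *
  -- With all entries nonzero, `N α · βγ = -N γ · αδ`. Taking norms of this, together with `N α · N
  -- β = N γ · N δ`, yields `N α = -N γ`; hence `βγ = αδ`, against the determinant.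
  have e0 : α * α1 * α2 * (β * γ) = -(γ * γ1 * γ2 * (α * δ)) := by linear_combination α * γ * h1
  have e1 : α * α1 * α2 * (β1 * γ1) = -(γ * γ1 * γ2 * (α1 * δ1)) := by
    linear_combination α1 * γ1 * h1'
  have e2 : α * α1 * α2 * (β2 * γ2) = -(γ * γ1 * γ2 * (α2 * δ2)) := by
    linear_combination α2 * γ2 * h1''
  have e3 : β * β1 * β2 * (α * δ) = -(δ * δ1 * δ2 * (β * γ)) := by linear_combination β * δ * h6
  have e4 : α * α1 * α2 * (β * β1 * β2) = γ * γ1 * γ2 * (δ * δ1 * δ2) := by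
    refine mul_right_cancel₀ (b := β * γ * (α * δ)) (by simp [*]) ?_
    linear_combination β * β1 * β2 * (α * δ) * e0 - γ * γ1 * γ2 * (α * δ) * e3
  have e5 : α * α1 * α2 = -(γ * γ1 * γ2) := by
    refine mul_right_cancel₀
      (b := γ * γ1 * γ2 * (δ * δ1 * δ2) * (α * α1 * α2) * (γ * γ1 * γ2)) (by simp [*]) ?_
    have e012 := congrArg₂ (· * ·) (congrArg₂ (· * ·) e0 e1) e2
    linear_combination e012 - (α * α1 * α2) ^ 2 * (γ * γ1 * γ2) * e4
  refine mul_left_cancel₀ (a := γ * γ1 * γ2) (by simp [*]) ?_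
  linear_combination e0 - β * γ * e5

open Polynomial in
/-- An affine substitution that maps the `q + 1` roots of `1 + r + r ^ (q + 1)` to roots of the
same polynomial is the identity. -/
theorem eq_id_of_affine (hσ : IsCubicFrobenius σ) {E A : L} (hA : A ≠ 0) {f : Option K → L}
    (hf : Function.Injective f) (h : ∀ i, 1 + f i + f i * σ (f i) = 0)
    (h' : ∀ i, 1 + (E + A * f i) + (E + A * f i) * σ (E + A * f i) = 0) : E = 0 ∧ A = 1 := by
  have : Fintype K := Fintype.ofFinite K
  have hq2 : 2 ≤ Nat.card K := two_le_card K
  obtain ⟨q, hq⟩ : ∃ q, q = Nat.card K := ⟨_, rfl⟩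
  rw [← hq] at hq2
  -- Subtracting `A σ(A)` times the original equation cancels the term of degree `q + 1`, leaving
  -- degree at most `q` with `q + 1` roots.
  let p : L[X] := C (1 + E + E * σ E - A * σ A) + C (A + A * σ E - A * σ A) * X ^ 1 +
    C (E * σ A) * X ^ q
  have hp : p = 0 := by
    refine eq_zero_of_natDegree_lt_card_of_eval_eq_zero _ hf (fun i => ?_) ?_
    · have e1 : f i ^ q = σ (f i) := by rw [hσ.apply_eq_pow, hq]
      have := h' i
      simp only [map_add, map_mul] at this
      simp only [p, eval_add, eval_mul, eval_C, eval_pow, eval_X, e1]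
      linear_combination this - A * σ A * h i
    · rw [Fintype.card_option, ← Nat.card_eq_fintype_card, ← hq]
      refine Nat.lt_succ_of_le (natDegree_le_iff_coeff_eq_zero.2 fun N hN => ?_)
      simp only [p, coeff_add, coeff_C_mul, coeff_X_pow, coeff_C]
      simp [show N ≠ 0 by omega, show N ≠ 1 by omega, show N ≠ q by omega]
  have hE : E = 0 := by
    have := congrArg (coeff · q) hp
    simp only [p, coeff_add, coeff_C_mul, coeff_X_pow, coeff_C, coeff_zero] at this
    simpa [show q ≠ 0 by omega, show q ≠ 1 by omega, hA] using this
  subst hE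
  have h1 := congrArg (coeff · 1) hp
  simp only [p, coeff_add, coeff_C_mul, coeff_X_pow, coeff_C, coeff_zero] at h1
  simp only [show 1 ≠ q by omega, map_zero, mul_zero, add_zero, if_true, if_false, mul_one,
    one_ne_zero, zero_add] at h1
  have h2 : A * (1 - σ A) = 0 := by linear_combination h1
  have h3 : σ A = σ 1 := by
    rcases mul_eq_zero.1 h2 with h | h
    · exact absurd h hA
    · rw [map_one]; linear_combination -h
  exact ⟨rfl, σ.injective h3⟩

end IsCubicFrobenius

end CubicFrobenius

/-! ### Line coordinates relative to a frame. -/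

section Coordinates

variable {L : Type*} [Field L]

theorem smul_eq_of_dotProduct_eq_zero {y y' : Fin 3 → L} (hy : y ≠ 0) (hy' : y' ≠ 0)
    (h : ∀ x, x ⬝ᵥ y = 0 → x ⬝ᵥ y' = 0) : ∃ c : L, c ≠ 0 ∧ y' = c • y := by
  obtain ⟨i, hi⟩ := Function.ne_iff.1 hy
  have key : ∀ j, y' j = (y' i / y i) * y j := by
    intro j
    -- This vector is orthogonal to `y`, and orthogonality to `y'` is exactly proportionality in the
    -- coordinates `i, j`.
    have := h (Pi.single j (y i) - Pi.single i (y j)) (by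
      rw [sub_dotProduct, single_dotProduct, single_dotProduct]; ring)
    rw [sub_dotProduct, single_dotProduct, single_dotProduct] at this
    have hi' : y i ≠ 0 := hi
    field_simp
    linear_combination this
  refine ⟨y' i / y i, ?_, funext key⟩
  intro h0
  exact hy' (funext fun j => by rw [key j, h0, zero_mul]; rfl)

/-- The coordinates of the line `m` in the frame given by the homography `G`. -/
noncomputable def lineCoord (G : Homography L) (m : Line L) : Fin 3 → L :=
  fun i => G (Pi.single i 1) ⬝ᵥ m.rep

theorem apply_dotProduct_rep (G : Homography L) (m : Line L) (x : Fin 3 → L) :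
    G x ⬝ᵥ m.rep = x ⬝ᵥ lineCoord G m := by
  have hx : x = ∑ i, x i • (Pi.single i 1 : Fin 3 → L) := by
    simpa using (pi_eq_sum_univ' x)
  conv_lhs => rw [hx, map_sum, sum_dotProduct]
  simp only [map_smul, smul_dotProduct, smul_eq_mul]
  rfl

theorem lineCoord_ne_zero (G : Homography L) (m : Line L) : lineCoord G m ≠ 0 := by
  intro h
  apply m.rep_nonzero
  rw [← dotProduct_eq_zero_iff]
  intro w
  have := apply_dotProduct_rep G m (G.symm w)
  rw [h, dotProduct_zero, LinearEquiv.apply_symm_apply] at this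
  rwa [dotProduct_comm]

theorem mk_mem_pointsOn {v : Fin 3 → L} (hv : v ≠ 0) (m : Line L) :
    Projectivization.mk L v hv ∈ pointsOn m ↔ v ⬝ᵥ m.rep = 0 := by
  conv_lhs => rw [← m.mk_rep]
  exact Projectivization.orthogonal_mk hv m.rep_nonzero

theorem mk_apply_mem_pointsOn (G : Homography L) {x : Fin 3 → L} (hx : G x ≠ 0) (m : Line L) :
    Projectivization.mk L (G x) hx ∈ pointsOn m ↔ x ⬝ᵥ lineCoord G m = 0 := by
  rw [mk_mem_pointsOn, apply_dotProduct_rep]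

theorem exists_lineCoord_eq (G : Homography L) {y : Fin 3 → L} (hy : y ≠ 0) :
    ∃ m : Line L, ∃ c : L, c ≠ 0 ∧ lineCoord G m = c • y := by
  have key : ∀ x, x ⬝ᵥ lineCoord G.symm (Projectivization.mk L y hy) =
      G.symm x ⬝ᵥ (Projectivization.mk L y hy).rep := fun x => (apply_dotProduct_rep _ _ _).symm
  refine ⟨Projectivization.mk L _ (lineCoord_ne_zero G.symm (Projectivization.mk L y hy)), ?_⟩
  refine smul_eq_of_dotProduct_eq_zero hy (lineCoord_ne_zero _ _) fun x hx => ?_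
  have hG : ∀ hx' : x ≠ 0, G x ≠ 0 := fun hx' => by simpa using hx'
  by_cases hx' : x = 0
  · simp [hx']
  rw [← mk_apply_mem_pointsOn G (hG hx')]
  refine (Projectivization.orthogonal_mk _ _).2 ?_
  rw [key, LinearEquiv.symm_apply_apply]
  exact (mk_mem_pointsOn hx' _).1 ((Projectivization.orthogonal_mk _ _).2 hx)

theorem smul_mk_eq (g : Homography L) {v : Fin 3 → L} (hv : v ≠ 0) :
    g • Projectivization.mk L v hv = Projectivization.mk L (g v) (by simpa using hv) := rfl

theorem mapsLine_iff (g : Homography L) (m m' : Line L) :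
    MapsLine g m m' ↔ ∀ x, g x ⬝ᵥ m'.rep = 0 ↔ x ⬝ᵥ m.rep = 0 := by
  constructor
  · intro h x
    by_cases hx : x = 0
    · simp [hx]
    have hgx : g x ≠ 0 := by simpa using hx
    rw [← mk_mem_pointsOn hgx, ← mk_mem_pointsOn hx, ← h, ← smul_mk_eq]
    constructor
    · rintro ⟨P, hP, hPx⟩
      exact (MulAction.injective g hPx) ▸ hP
    · exact fun hP => ⟨_, hP, rfl⟩
  · intro h
    ext P
    induction P using Projectivization.ind with | h v hv =>
    have hv' : g.symm v ≠ 0 := by simpa using hv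
    have e : Projectivization.mk L v hv = g • Projectivization.mk L _ hv' := by
      simp
    rw [mk_mem_pointsOn, e]
    have := h (g.symm v)
    rw [LinearEquiv.apply_symm_apply] at this
    rw [this, ← mk_mem_pointsOn hv']
    constructor
    · rintro ⟨P, hP, hPx⟩
      exact (MulAction.injective g hPx) ▸ hP
    · exact fun hP => ⟨_, hP, rfl⟩

theorem mapsLine_iff_lineCoord (g : Homography L) (m m' : Line L) :
    MapsLine g m m' ↔ ∃ c : L, c ≠ 0 ∧ lineCoord g m' = c • m.rep := by
  rw [mapsLine_iff]
  simp only [apply_dotProduct_rep]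
  constructor
  · exact fun h => smul_eq_of_dotProduct_eq_zero m.rep_nonzero (lineCoord_ne_zero _ _)
      fun x => (h x).2
  · rintro ⟨c, hc, h⟩ x
    rw [h]
    simp [hc]

end Coordinates

/-! ### The cyclic model of an exterior subplane. -/

section Model

variable {K L : Type*} [Field K] [Field L] [Algebra K L]

/-- The point `(z, σ z, σ² z)`. -/
def vec (σ : L →ₐ[K] L) (z : L) : Fin 3 → L := ![z, σ z, σ (σ z)]

theorem vec_dotProduct (σ : L →ₐ[K] L) (z : L) (y : Fin 3 → L) :
    vec σ z ⬝ᵥ y = z * y 0 + σ z * y 1 + σ (σ z) * y 2 := by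
  simp [vec, dotProduct, Fin.sum_univ_three]

theorem vec_ne_zero (σ : L →ₐ[K] L) {z : L} (hz : z ≠ 0) : vec σ z ≠ 0 := fun h =>
  hz (by simpa [vec] using congrFun h 0)

/-- In the frame given by `G`, the subplane `π` consists of the points `(z, σ z, σ² z)`, and the
exterior line `l` is the line `x = 0`. -/
structure IsModel (σ : L →ₐ[K] L) (G : Homography L) (π : Set (Point L)) (l : Line L) : Prop where
  mem_iff : ∀ P, P ∈ π ↔ ∃ z, ∃ h : G (vec σ z) ≠ 0, P = Projectivization.mk L _ h
  lineCoord_eq : lineCoord G l = ![1, 0, 0]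

/-- If `a` are the coordinates of `l` in the frame `g`, then `k ↦ ∑ kⱼ aⱼ` is a `K`-linear map from
`K³` to `L`. Its kernel is trivial because no point of the subplane lies on `l`, so it is bijective
by dimension. The matrix with columns `vec σ (a j)` therefore sends the `K`-rational vectors onto
the `vec σ z`, and its first row is the equation of `l`. The vectors `a` are kept in order to
transport quadratic forms between the two frames. -/
theorem exists_isModel (hL : Module.finrank K L = 3) {σ : L →ₐ[K] L} (hσ : IsCubicFrobenius σ)
    {g : Homography L} {l : Line L} (hext : IsExterior (image g (standardSubplane K)) l) :
    ∃ G : Homography L, IsModel σ G (image g (standardSubplane K)) l ∧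
      ∃ a : Fin 3 → L, ∀ j, G (vec σ (a j)) = g (Pi.single j 1) := by
  have : Module.Finite K L := Module.finite_of_finrank_pos (by omega)
  set a := lineCoord g l with ha
  let A : (Fin 3 → K) →ₗ[K] L := Fintype.linearCombination K a
  have hA : ∀ k, A k = ∑ j, algebraMap K L (k j) * a j := fun k => by
    simp [A, Fintype.linearCombination_apply, Algebra.smul_def]
  have hA' : ∀ k, A k = (fun i => algebraMap K L (k i)) ⬝ᵥ a := fun k => hA k
  have hAinj : Function.Injective A := by
    rw [← LinearMap.ker_eq_bot, LinearMap.ker_eq_bot']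
    intro k hk
    by_contra hk0
    have hk1 : (fun i => algebraMap K L (k i)) ≠ 0 := fun h =>
      hk0 (funext fun i => by simpa using congrFun h i)
    refine Set.disjoint_left.1 hext
      (show g • Projectivization.mk L _ hk1 ∈ _ from ⟨_, ⟨k, hk1, rfl⟩, rfl⟩) ?_
    rw [smul_mk_eq, mk_apply_mem_pointsOn, ← ha, ← hA', hk]
  have hAsurj : Function.Surjective A :=
    (LinearMap.injective_iff_surjective_of_finrank_eq_finrank (by simp [hL])).1 hAinj
  let M : Matrix (Fin 3) (Fin 3) L := Matrix.of fun i j => vec σ (a j) i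
  have hMk : ∀ k : Fin 3 → K, M.mulVec (fun i => algebraMap K L (k i)) = vec σ (A k) := by
    intro k
    funext i
    fin_cases i <;>
      simp [M, Matrix.mulVec, dotProduct, Fin.sum_univ_three, vec, hA, mul_comm]
  have hMe : ∀ j, M.mulVec (Pi.single j 1) = vec σ (a j) := fun j => by
    rw [Matrix.mulVec_single_one]; rfl
  have hM0 : ∀ x, (M.mulVec x) 0 = x ⬝ᵥ a := fun x => by
    simp [M, Matrix.mulVec, dotProduct, Fin.sum_univ_three, vec, mul_comm]
  -- A row vector killing `M` is a linear relation between `1, σ, σ²` on all of `L`.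
  have hMu : IsUnit M := by
    rw [← Matrix.vecMul_injective_iff_isUnit]
    have : ∀ y, Matrix.vecMul y M = 0 → y = 0 := by
      intro y hy
      have := hσ.eq_zero_of_forall (a := y 0) (b := y 1) (c := y 2) fun z => by
        obtain ⟨k, rfl⟩ := hAsurj z
        have e : y ⬝ᵥ M.mulVec (fun i => algebraMap K L (k i)) = 0 := by
          rw [Matrix.dotProduct_mulVec, hy, zero_dotProduct]
        rw [hMk, dotProduct_comm, vec_dotProduct] at e
        linear_combination e
      obtain ⟨h0, h1, h2⟩ := this
      funext i
      fin_cases i <;> assumption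
    exact (injective_iff_map_eq_zero (Matrix.vecMulLinear M)).2 this
  let e : Homography L := LinearEquiv.ofBijective M.mulVecLin
    ⟨Matrix.mulVec_injective_iff_isUnit.2 hMu, Matrix.mulVec_surjective_iff_isUnit.2 hMu⟩
  have he : ∀ x, e x = M.mulVec x := fun x => rfl
  have hes : ∀ x, (e.symm.trans g) (M.mulVec x) = g x := fun x => by
    rw [LinearEquiv.trans_apply, ← he, LinearEquiv.symm_apply_apply]
  refine ⟨e.symm.trans g, ⟨fun P => ?_, ?_⟩, a, fun j => ?_⟩
  · constructor
    · rintro ⟨_, ⟨k, hk, rfl⟩, rfl⟩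
      refine ⟨A k, ?_, ?_⟩
      · rw [← hMk, hes]; simpa using hk
      · simp only [smul_mk_eq, ← hMk, hes]
    · rintro ⟨z, h, rfl⟩
      obtain ⟨k, rfl⟩ := hAsurj z
      simp only [← hMk, hes] at h ⊢
      have hk : (fun i => algebraMap K L (k i)) ≠ 0 := by simpa using h
      exact ⟨Projectivization.mk L _ hk, ⟨k, hk, rfl⟩, rfl⟩
  · have key : ∀ x, x ⬝ᵥ lineCoord (e.symm.trans g) l = x 0 := by
      intro x
      rw [← apply_dotProduct_rep, ← e.apply_symm_apply x]
      rw [he (e.symm x), hes, apply_dotProduct_rep, hM0]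
    funext i
    have := key (Pi.single i 1)
    rw [single_dotProduct, one_mul] at this
    rw [this]
    fin_cases i <;> simp
  · rw [← hMe, hes]

variable {σ : L →ₐ[K] L}

/-- Two elements of `L` that are independent over `K` are orthogonal to a common element. -/
theorem smul_vec_of_dotProduct_eq_zero (hσ : IsCubicFrobenius σ) {z z' : L} {y : Fin 3 → L}
    (hz : z ≠ 0) (hzz' : ∀ k, z' ≠ algebraMap K L k * z) (hy : y ≠ 0) (h : vec σ z ⬝ᵥ y = 0)
    (h' : vec σ z' ⬝ᵥ y = 0) : ∃ u, u ≠ 0 ∧ ∃ c : L, c ≠ 0 ∧ y = c • vec σ u := by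
  rw [vec_dotProduct] at h h'
  -- The cross product of `vec σ z` and `vec σ z'` is `vec σ u` for this `u`; it vanishes only if
  -- `z' / z` is fixed by `σ`.
  set u := σ z * σ (σ z') - σ (σ z) * σ z' with hu
  have hu0 : u ≠ 0 := by
    intro h0
    have h2 : z * σ z' - σ z * z' = 0 := σ.injective (by
      rw [map_sub, map_mul, map_mul, map_zero]; exact h0)
    obtain ⟨k, hk⟩ := hσ.fixed (z' / z) (by
      have := IsCubicFrobenius.ne_zero σ hz
      rw [map_div₀]
      field_simp
      linear_combination h2)
    exact hzz' k (by rw [hk]; field_simp)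
  have hu1 : σ u = σ (σ z) * z' - z * σ (σ z') := by simp [hu, hσ.cube]
  have hu2 : σ (σ u) = z * σ z' - σ z * z' := by rw [hu1]; simp [hσ.cube]
  refine ⟨u, hu0, smul_eq_of_dotProduct_eq_zero (vec_ne_zero σ hu0) hy fun x hx => ?_⟩
  have p01 : y 0 * σ u = y 1 * u := by
    rw [hu1, hu]; linear_combination σ (σ z) * h' - σ (σ z') * h
  have p02 : y 0 * σ (σ u) = y 2 * u := by
    rw [hu2, hu]; linear_combination σ z' * h - σ z * h'
  rw [dotProduct_comm, vec_dotProduct] at hx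
  simp only [dotProduct, Fin.sum_univ_three]
  refine mul_right_cancel₀ hu0 ?_
  linear_combination y 0 * hx - x 1 * p01 - x 2 * p02

/-- The point `z` is on the line `u` iff `Tr (z u) = 0`. The kernel of the trace has `K`-dimension
at least two, since its values lie in `K`; dividing two independent kernel elements by `u` gives two
distinct points on the line. -/
theorem IsModel.mem_linesOf_iff (hL : Module.finrank K L = 3) (hσ : IsCubicFrobenius σ)
    {G : Homography L} {π : Set (Point L)} {l : Line L} (hG : IsModel σ G π l) (m : Line L) :
    m ∈ linesOf π ↔ ∃ u, u ≠ 0 ∧ ∃ c : L, c ≠ 0 ∧ lineCoord G m = c • vec σ u := by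
  have : Module.Finite K L := Module.finite_of_finrank_pos (by omega)
  have hGv : ∀ {z : L}, z ≠ 0 → G (vec σ z) ≠ 0 := fun hz => by simpa using vec_ne_zero σ hz
  constructor
  · rintro ⟨P, hP, Q, hQ, hPQ, hPm, hQm⟩
    obtain ⟨z, hz, rfl⟩ := (hG.mem_iff P).1 hP
    obtain ⟨z', hz', rfl⟩ := (hG.mem_iff Q).1 hQ
    rw [mk_apply_mem_pointsOn] at hPm hQm
    have hz0 : z ≠ 0 := by rintro rfl; simp [vec] at hz
    refine smul_vec_of_dotProduct_eq_zero hσ hz0 (fun k hk => hPQ ?_) (lineCoord_ne_zero G m) hPm hQm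
    rw [eq_comm, Projectivization.mk_eq_mk_iff']
    refine ⟨algebraMap K L k, ?_⟩
    rw [← map_smul]
    congr 1
    funext i
    fin_cases i <;> simp [vec, hk]
  · rintro ⟨u, hu, c, hc, h⟩
    let T : L →ₗ[K] L := LinearMap.id + σ.toLinearMap + σ.toLinearMap ∘ₗ σ.toLinearMap
    have hT : ∀ z, T z = z + σ z + σ (σ z) := fun z => rfl
    have hr : Module.finrank K (LinearMap.range T) ≤ 1 := by
      have hle : LinearMap.range T ≤ Submodule.span K {(1 : L)} := by
        rintro _ ⟨z, rfl⟩
        obtain ⟨k, hk⟩ := hσ.fixed (T z) (by simp only [hT, map_add, hσ.cube]; ring)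
        rw [Submodule.mem_span_singleton]
        exact ⟨k, by rw [← hk, Algebra.smul_def, mul_one]⟩
      exact (Submodule.finrank_mono hle).trans (finrank_span_le_card _ |>.trans (by simp))
    have hk := LinearMap.finrank_range_add_finrank_ker T
    rw [hL] at hk
    have hker : 1 < Module.finrank K (LinearMap.ker T) := by omega
    have : Nontrivial (LinearMap.ker T) := Module.nontrivial_of_finrank_pos (R := K) (by omega)
    obtain ⟨w, hw⟩ := exists_ne (0 : LinearMap.ker T)
    obtain ⟨w', hww'⟩ := exists_linearIndependent_pair_of_one_lt_finrank hker hw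
    have hw0 : (w : L) ≠ 0 := by simpa using hw
    have hw0' : (w' : L) ≠ 0 := by simpa using hww'.ne_zero 1
    have hwT : ∀ v : LinearMap.ker T, (v : L) + σ v + σ (σ v) = 0 := fun v => v.2
    have hu1 := IsCubicFrobenius.ne_zero σ hu
    have hu2 := IsCubicFrobenius.ne_zero σ hu1
    refine ⟨Projectivization.mk L _ (hGv (div_ne_zero hw0 hu)), (hG.mem_iff _).2 ⟨_, _, rfl⟩,
      Projectivization.mk L _ (hGv (div_ne_zero hw0' hu)), (hG.mem_iff _).2 ⟨_, _, rfl⟩, ?_, ?_, ?_⟩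
    · intro he
      obtain ⟨c, hc⟩ := (Projectivization.mk_eq_mk_iff' _ _ _ _ _).1 he
      rw [← map_smul] at hc
      have hc := G.injective hc
      have c0 : c * (w' / u) = w / u := by simpa [vec] using congrFun hc 0
      have c1 : c * σ (w' / u) = σ (w / u) := by simpa [vec] using congrFun hc 1
      have c0' : c * w' = w := by field_simp at c0; exact c0
      have c1' : c * σ w' = σ w := by
        rw [map_div₀, map_div₀] at c1; field_simp at c1; exact c1
      obtain ⟨k, rfl⟩ := hσ.fixed c (by
        rw [← c0', map_mul] at c1'
        exact (mul_right_cancel₀ (IsCubicFrobenius.ne_zero σ hw0') c1').symm)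
      have := (LinearIndependent.pair_iff.1 hww') 1 (-k) (Subtype.ext (by
        simp [Algebra.smul_def, c0']))
      simp at this
    · rw [mk_apply_mem_pointsOn, h, dotProduct_smul, vec_dotProduct]
      simp only [vec, map_div₀]
      have := hwT w
      simp [hu, hu1, hu2, this]
    · rw [mk_apply_mem_pointsOn, h, dotProduct_smul, vec_dotProduct]
      simp only [vec, map_div₀]
      have := hwT w'
      simp [hu, hu1, hu2, this]

/-- The points of the exterior line in which it meets the lines `(u, σ u, σ² u)` with `C u`, in
the frame given by `G`. -/
def traceCurve (σ : L →ₐ[K] L) (G : Homography L) (C : L → Prop) : Set (Point L) :=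
  {X | ∃ s t, ∃ h : G ![0, s, t] ≠ 0, X = Projectivization.mk L _ h ∧
    ∃ u, u ≠ 0 ∧ C u ∧ σ u * s + σ (σ u) * t = 0}

theorem IsModel.trace_eq (hL : Module.finrank K L = 3) (hσ : IsCubicFrobenius σ)
    {G : Homography L} {π : Set (Point L)} {l : Line L} (hG : IsModel σ G π l)
    {D : Set (Line L)} {C : L → Prop}
    (hD : ∀ (m : Line L) (u c : L), u ≠ 0 → c ≠ 0 → lineCoord G m = c • vec σ u → (m ∈ D ↔ C u)) :
    trace l {m | m ∈ linesOf π ∧ m ∈ D} = traceCurve σ G C := by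
  have hl : ∀ x, x ⬝ᵥ lineCoord G l = x 0 := fun x => by
    simp [hG.lineCoord_eq, dotProduct, Fin.sum_univ_three]
  have hinc : ∀ (u s t : L), ![0, s, t] ⬝ᵥ vec σ u = σ u * s + σ (σ u) * t := fun u s t => by
    simp [vec, dotProduct, Fin.sum_univ_three, mul_comm]
  ext X
  constructor
  · rintro ⟨hX, m, ⟨hm, hmD⟩, hXm⟩
    obtain ⟨u, hu, c, hc, hmu⟩ := (hG.mem_linesOf_iff hL hσ m).1 hm
    induction X using Projectivization.ind with | h v hv =>
    obtain ⟨x, rfl⟩ := G.surjective v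
    rw [mk_apply_mem_pointsOn] at hX hXm
    rw [hl] at hX
    have hx : x = ![0, x 1, x 2] := by
      funext i
      fin_cases i <;> simp [hX]
    rw [hx] at hv hXm
    rw [hmu, dotProduct_smul, hinc] at hXm
    refine ⟨x 1, x 2, hv, ?_, u, hu, (hD m u c hu hc hmu).1 hmD, ?_⟩
    · congr 2
    · simpa [hc] using hXm
  · rintro ⟨s, t, h, rfl, u, hu, hCu, hst⟩
    obtain ⟨m, c, hc, hmu⟩ := exists_lineCoord_eq G (vec_ne_zero σ hu)
    refine ⟨?_, m, ⟨(hG.mem_linesOf_iff hL hσ m).2 ⟨u, hu, c, hc, hmu⟩,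
      (hD m u c hu hc hmu).2 hCu⟩, ?_⟩
    · rw [mk_apply_mem_pointsOn, hl]; rfl
    · rw [mk_apply_mem_pointsOn, hmu, dotProduct_smul, hinc, hst, smul_zero]

end Model

/-! ### The fixed lines are the sides of the coordinate triangle. -/

section FixedLines

variable {K L : Type*} [Field K] [Field L] [Algebra K L] {σ : L →ₐ[K] L}

theorem vec_smul (σ : L →ₐ[K] L) (k : K) (z : L) :
    vec σ (algebraMap K L k * z) = algebraMap K L k • vec σ z := by
  funext i
  fin_cases i <;> simp [vec]

theorem IsCubicFrobenius.linearMap_eq_zero (hσ : IsCubicFrobenius σ) {F : (Fin 3 → L) →ₗ[L] L}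
    (h : ∀ z, F (vec σ z) = 0) : F = 0 := by
  have key : ∀ x, F x = x 0 * F (Pi.single 0 1) + x 1 * F (Pi.single 1 1) +
      x 2 * F (Pi.single 2 1) := fun x => by
    conv_lhs => rw [pi_eq_sum_univ' x]
    simp [Fin.sum_univ_three]
  obtain ⟨h0, h1, h2⟩ := hσ.eq_zero_of_forall (a := F (Pi.single 0 1)) (b := F (Pi.single 1 1))
    (c := F (Pi.single 2 1)) fun z => by
      have := h z
      rw [key] at this
      simp only [vec, Matrix.cons_val_zero, Matrix.cons_val_one, Matrix.cons_val] at this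
      linear_combination this
  refine LinearMap.ext fun x => ?_
  rw [key, h0, h1, h2]
  simp

/-- A linear map for which all `(z, σ z, σ² z)` are eigenvectors is a homothety. -/
theorem IsCubicFrobenius.exists_eq_smul (hσ : IsCubicFrobenius σ)
    {T : (Fin 3 → L) →ₗ[L] (Fin 3 → L)} (h : ∀ z, ∃ μ : L, T (vec σ z) = μ • vec σ z) :
    ∃ μ : L, ∀ x, T x = μ • x := by
  choose τ hτ using h
  have hadd : ∀ z w, vec σ (z + w) = vec σ z + vec σ w := fun z w => by
    funext i
    fin_cases i <;> simp [vec]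
  have key : ∀ z, T (vec σ z) = τ 1 • vec σ z := by
    intro z
    by_cases hz : σ z = z
    · obtain ⟨k, rfl⟩ := hσ.fixed z hz
      rw [← mul_one (algebraMap K L k), vec_smul, map_smul, hτ 1, smul_comm]
    -- The eigenvalues at `1`, `z` and `1 + z` agree, because `(1, 1)` and `(z, σ z)` are
    -- independent when `σ z ≠ z`.
    · have e := hτ (1 + z)
      rw [hadd, map_add, hτ 1, hτ z] at e
      have e0 : τ 1 + τ z * z = τ (1 + z) * (1 + z) := by simpa [vec] using congrFun e 0
      have e1 : τ 1 + τ z * σ z = τ (1 + z) * (1 + σ z) := by simpa [vec] using congrFun e 1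
      have e2 : (τ z - τ (1 + z)) * (σ z - z) = 0 := by linear_combination e1 - e0
      have e3 : τ z = τ (1 + z) := by
        simpa [sub_ne_zero.2 hz, sub_eq_zero] using e2
      have e4 : τ z = τ 1 := by
        rw [← e3] at e0
        linear_combination -e0
      rw [hτ z, e4]
  refine ⟨τ 1, fun x => funext fun i => ?_⟩
  have := hσ.linearMap_eq_zero (F := LinearMap.proj i ∘ₗ (T - τ 1 • LinearMap.id)) fun z => by
    simp [key]
  have := LinearMap.congr_fun this x
  simpa [sub_eq_zero] using this

/-- The `σ`-semilinear map that fixes all `(z, σ z, σ² z)`. -/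
def conj (σ : L →ₐ[K] L) (x : Fin 3 → L) : Fin 3 → L := ![σ (x 2), σ (x 0), σ (x 1)]

theorem conj_add (σ : L →ₐ[K] L) (x y : Fin 3 → L) : conj σ (x + y) = conj σ x + conj σ y := by
  funext i
  fin_cases i <;> simp [conj]

theorem conj_smul (σ : L →ₐ[K] L) (c : L) (x : Fin 3 → L) :
    conj σ (c • x) = σ c • conj σ x := by
  funext i
  fin_cases i <;> simp [conj]

theorem IsCubicFrobenius.conj_vec (hσ : IsCubicFrobenius σ) (z : L) :
    conj σ (vec σ z) = vec σ z := by
  funext i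
  fin_cases i <;> simp [conj, vec, hσ.cube]

/-- The three lines of the triangle conjugate to the exterior line are fixed lines. -/
theorem IsModel.mem_fixedLines (hσ : IsCubicFrobenius σ) {G : Homography L} {π : Set (Point L)}
    {l : Line L} (hG : IsModel σ G π l) {m : Line L} {i : Fin 3} {c : L} (hc : c ≠ 0)
    (hm : lineCoord G m = c • Pi.single i 1) : m ∈ fixedLines π l := by
  rintro h ⟨hπ, hl⟩
  let H : Homography L := (G.trans h).trans G.symm
  have hGH : ∀ x, G (H x) = h (G x) := fun x => by simp [H]
  obtain ⟨α, hα, hα'⟩ := (mapsLine_iff_lineCoord h l l).1 hl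
  have hl0 : ∀ x, x ⬝ᵥ lineCoord G l = x 0 := fun x => by
    simp [hG.lineCoord_eq, dotProduct, Fin.sum_univ_three]
  have hH0 : ∀ x, H x 0 = α * x 0 := fun x => by
    rw [← hl0 (H x), ← apply_dotProduct_rep, hGH, apply_dotProduct_rep, hα', dotProduct_smul,
      apply_dotProduct_rep, hl0, smul_eq_mul]
  have hHv : ∀ z, ∃ c w : L, H (vec σ z) = c • vec σ w := by
    intro z
    by_cases hz : z = 0
    · refine ⟨0, 0, ?_⟩
      have : vec σ z = 0 := by
        funext i
        fin_cases i <;> simp [vec, hz]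
      rw [this, map_zero, zero_smul]
    have hGz : G (vec σ z) ≠ 0 := by simpa using vec_ne_zero σ hz
    have hmem : h • Projectivization.mk L _ hGz ∈ π := by
      refine hπ.subset ?_
      exact ⟨_, (hG.mem_iff _).2 ⟨z, hGz, rfl⟩, rfl⟩
    obtain ⟨w, hw, he⟩ := (hG.mem_iff _).1 hmem
    rw [smul_mk_eq] at he
    obtain ⟨c, hc⟩ := (Projectivization.mk_eq_mk_iff' _ _ _ _ _).1 he
    refine ⟨c, w, G.injective ?_⟩
    rw [hGH, map_smul, hc]
  -- The twist of `H` by `conj σ`, whose inverse is its square. It sends each `vec σ z` to a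
  -- multiple of `H (vec σ z)`, so it is `μ • H`. As `conj σ` permutes the coordinates cyclically,
  -- the shape of the first row of `H`, known from fixing `l`, passes to the other rows: `H` is
  -- diagonal.
  let H' : (Fin 3 → L) →ₗ[L] (Fin 3 → L) :=
    { toFun := fun x => conj σ (H (conj σ (conj σ x)))
      map_add' := fun x y => by simp only [conj_add, map_add]
      map_smul' := fun c x => by simp only [conj_smul, map_smul, hσ.cube, RingHom.id_apply] }
  obtain ⟨μ, hμ⟩ := hσ.exists_eq_smul (T := H.symm.toLinearMap ∘ₗ H') fun z => by
    obtain ⟨c, w, hcw⟩ := hHv z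
    have hH' : H' (vec σ z) = σ c • vec σ w := by
      change conj σ (H (conj σ (conj σ (vec σ z)))) = _
      rw [hσ.conj_vec, hσ.conj_vec, hcw, conj_smul, hσ.conj_vec]
    by_cases hc0 : c = 0
    · refine ⟨0, ?_⟩
      simp [hH', hc0]
    · refine ⟨σ c / c, ?_⟩
      have : vec σ w = c⁻¹ • H (vec σ z) := by rw [hcw, smul_smul, inv_mul_cancel₀ hc0, one_smul]
      simp [hH', this, smul_smul, div_eq_mul_inv]
  have hμ' : ∀ x, conj σ (H (conj σ (conj σ x))) = μ • H x := fun x => by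
    have := congrArg H (hμ x)
    rw [map_smul, LinearMap.comp_apply, LinearEquiv.coe_coe, LinearEquiv.apply_symm_apply] at this
    exact this
  have hH1 : ∀ x, σ α * x 1 = μ * H x 1 := fun x => by
    have := congrFun (hμ' x) 1
    simpa [conj, hH0, hσ.cube] using this
  have hμ0 : μ ≠ 0 := by
    rintro rfl
    have := hH1 (Pi.single 1 1)
    simp [hα] at this
  have hH2 : ∀ x, σ (σ α) * x 2 = σ μ * (μ * H x 2) := fun x => by
    have h2 := congrFun (hμ' x) 2
    have h1 := congrArg σ (hH1 (conj σ (conj σ x)))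
    simp only [conj, Matrix.cons_val, Pi.smul_apply, smul_eq_mul, map_mul, hσ.cube,
      Matrix.cons_val_zero, Matrix.cons_val_one] at h1 h2
    rw [h1, h2]
  have hHi : ∀ x, H x i = 0 ↔ x i = 0 := by
    intro x
    fin_cases i
    · simp [hH0, hα]
    · have := hH1 x
      constructor
      · intro hx
        simpa [show H x 1 = 0 from hx, hα] using this
      · intro hx
        simpa [show x 1 = 0 from hx, hμ0] using this
    · have := hH2 x
      constructor
      · intro hx
        simpa [show H x 2 = 0 from hx, hα] using this
      · intro hx
        simpa [show x 2 = 0 from hx, hμ0] using this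
  rw [mapsLine_iff]
  intro y
  obtain ⟨x, rfl⟩ := G.surjective y
  rw [← hGH, apply_dotProduct_rep, apply_dotProduct_rep, hm]
  simpa [hc] using hHi x

/-- At most one coordinate of a fixed line is nonzero. -/
theorem IsModel.mul_eq_zero_of_mem_fixedLines (hσ : IsCubicFrobenius σ) {G : Homography L}
    {π : Set (Point L)} {l : Line L} (hG : IsModel σ G π l) {m : Line L} (hm : m ∈ fixedLines π l) :
    lineCoord G m 1 * lineCoord G m 2 = 0 ∧ lineCoord G m 2 * lineCoord G m 0 = 0 ∧
      lineCoord G m 0 * lineCoord G m 1 = 0 := by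
  obtain ⟨c, hc, h1, h2, h3⟩ := hσ.exists_generic
  have hc1 := IsCubicFrobenius.ne_zero σ hc
  have hc2 := IsCubicFrobenius.ne_zero σ hc1
  have hcv : ∀ i, vec σ c i ≠ 0 := fun i => by fin_cases i <;> simpa [vec] using hc
  -- The diagonal map `diag(c, σ c, σ² c)` sends `vec σ z` to `vec σ (c * z)`, so it stabilises both
  -- `π` and `l`. Its eigenvalues are distinct, so a line it fixes has at most one nonzero
  -- coordinate.
  let S : Homography L := LinearEquiv.piCongrRight fun i => LinearEquiv.smulOfNeZero L L _ (hcv i)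
  have hS : ∀ x i, S x i = vec σ c i * x i := fun x i => rfl
  have hSv : ∀ z, S (vec σ z) = vec σ (c * z) := fun z => by
    funext i
    rw [hS]
    fin_cases i <;> simp [vec]
  let h : Homography L := (G.symm.trans S).trans G
  have hh : ∀ x, h (G x) = G (S x) := fun x => by simp [h]
  have hstab : h ∈ stabilizer π l := by
    constructor
    · ext P
      constructor
      · rintro ⟨Q, hQ, rfl⟩
        obtain ⟨z, hz, rfl⟩ := (hG.mem_iff Q).1 hQ
        rw [hG.mem_iff]
        refine ⟨c * z, ?_, ?_⟩
        · rw [← hSv, ← hh]; simpa using hz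
        · simp only [smul_mk_eq, hh, hSv]
      · intro hP
        obtain ⟨z, hz, rfl⟩ := (hG.mem_iff P).1 hP
        have e : z = c * (z / c) := by field_simp
        have hz' : G (vec σ (z / c)) ≠ 0 := by
          rw [e, ← hSv] at hz
          simpa using hz
        refine ⟨Projectivization.mk L _ hz', (hG.mem_iff _).2 ⟨_, hz', rfl⟩, ?_⟩
        simp only [smul_mk_eq, hh, hSv, ← e]
    · rw [mapsLine_iff]
      intro x
      obtain ⟨y, rfl⟩ := G.surjective x
      rw [hh, apply_dotProduct_rep, apply_dotProduct_rep, hG.lineCoord_eq]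
      simp [dotProduct, Fin.sum_univ_three, hS, vec, hc]
  obtain ⟨d, hd, he⟩ := (mapsLine_iff_lineCoord h m m).1 (hm h hstab)
  have key : ∀ i, vec σ c i * lineCoord G m i = d * lineCoord G m i := by
    intro i
    have e : h (G (Pi.single i 1)) ⬝ᵥ m.rep = d * lineCoord G m i := by
      rw [apply_dotProduct_rep, he, dotProduct_smul]; rfl
    rw [hh, apply_dotProduct_rep] at e
    rw [← e]
    have : S (Pi.single i 1) = Pi.single i (vec σ c i) := by
      funext j
      rw [hS]
      by_cases hij : j = i
      · subst hij; simp
      · simp [hij]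
    rw [this, single_dotProduct]
  have k0 : c * lineCoord G m 0 = d * lineCoord G m 0 := key 0
  have k1 : σ c * lineCoord G m 1 = d * lineCoord G m 1 := key 1
  have k2 : σ (σ c) * lineCoord G m 2 = d * lineCoord G m 2 := key 2
  refine ⟨?_, ?_, ?_⟩
  · refine mul_left_cancel₀ (sub_ne_zero.2 h3) ?_
    linear_combination lineCoord G m 1 * k2 - lineCoord G m 2 * k1
  · refine mul_left_cancel₀ (sub_ne_zero.2 h2) ?_
    linear_combination lineCoord G m 0 * k2 - lineCoord G m 2 * k0
  · refine mul_left_cancel₀ (sub_ne_zero.2 h1) ?_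
    linear_combination lineCoord G m 0 * k1 - lineCoord G m 1 * k0

end FixedLines

/-! ### Equations of the special dual conics. -/

section DualConic

variable {K L : Type*} [Field K] [Field L] [Algebra K L]

open MvPolynomial in
theorem exists_eq_sum_of_isHomogeneous_two {R ι : Type*} [CommRing R] [Fintype ι] [DecidableEq ι]
    {f : MvPolynomial ι R} (hf : f.IsHomogeneous 2) :
    ∃ c : ι → ι → R, f = ∑ i, ∑ j, C (c i j) * (X i * X j) := by
  have hmon : ∀ d : ι →₀ ℕ, d.degree = 2 → ∀ r : R,
      ∃ c : ι → ι → R, monomial d r = ∑ i, ∑ j, C (c i j) * (X i * X j) := by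
    intro d hd r
    obtain ⟨i, j, rfl⟩ : ∃ i j, d = Finsupp.single i 1 + Finsupp.single j 1 := by
      have hd0 : d ≠ 0 := by rintro rfl; simp at hd
      obtain ⟨i, hi⟩ := Finsupp.ne_iff.1 hd0
      have hi' : Finsupp.single i 1 ≤ d := by
        rw [Finsupp.single_le_iff]; exact Nat.one_le_iff_ne_zero.2 hi
      obtain ⟨e, rfl⟩ := exists_add_of_le hi'
      rw [map_add, Finsupp.degree_single] at hd
      have he : e.degree = 1 := by omega
      have he0 : e ≠ 0 := by rintro rfl; simp at he
      obtain ⟨j, hj⟩ := Finsupp.ne_iff.1 he0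
      have hj' : Finsupp.single j 1 ≤ e := by
        rw [Finsupp.single_le_iff]; exact Nat.one_le_iff_ne_zero.2 hj
      obtain ⟨e', rfl⟩ := exists_add_of_le hj'
      rw [map_add, Finsupp.degree_single] at he
      have he' : e' = 0 := (Finsupp.degree_eq_zero_iff e').1 (by omega)
      exact ⟨i, j, by rw [he', add_zero]⟩
    refine ⟨fun i' j' => if i' = i ∧ j' = j then r else 0, ?_⟩
    rw [Finset.sum_eq_single i, Finset.sum_eq_single j]
    · simp only [and_self, if_true]
      rw [X, X, monomial_mul, C_mul_monomial]; simp
    · intro j' _ hj'; simp [hj']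
    · simp
    · intro i' _ hi'; simp [hi']
    · simp
  have key : ∀ s : Finset (ι →₀ ℕ), (∀ d ∈ s, d.degree = 2) → ∀ a : (ι →₀ ℕ) → R,
      ∃ c : ι → ι → R, ∑ d ∈ s, monomial d (a d) = ∑ i, ∑ j, C (c i j) * (X i * X j) := by
    intro s
    induction s using Finset.induction_on with
    | empty => exact fun _ _ => ⟨0, by simp⟩
    | insert d s hds ih =>
      intro hs a
      obtain ⟨c, hc⟩ := ih (fun d hd => hs d (Finset.mem_insert_of_mem hd)) a
      obtain ⟨c', hc'⟩ := hmon d (hs d (Finset.mem_insert_self d s)) (a d)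
      refine ⟨c' + c, ?_⟩
      rw [Finset.sum_insert hds, hc, hc']
      simp only [← Finset.sum_add_distrib, Pi.add_apply, map_add, add_mul]
  rw [f.as_sum]
  refine key f.support (fun d hd => ?_) _
  rw [Finsupp.degree_eq_weight_one]
  exact hf (mem_support_iff.1 hd)

theorem aeval_sum_quadratic (c : Fin 3 → Fin 3 → K) (x : Fin 3 → L) :
    MvPolynomial.aeval x (∑ i, ∑ j, MvPolynomial.C (c i j) *
      (MvPolynomial.X i * MvPolynomial.X j) : MvPolynomial (Fin 3) K) =
      ∑ i, ∑ j, algebraMap K L (c i j) * (x i * x j) := by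
  simp [map_sum]

/-- The values at the three unit vectors and their pairwise sums determine a quadratic form, so this
holds even over the field with two elements. -/
theorem eq_zero_of_isHomogeneous_two {f : MvPolynomial (Fin 3) K} (hf : f.IsHomogeneous 2)
    (h : ∀ x : Fin 3 → L, MvPolynomial.aeval x f = 0) : f = 0 := by
  obtain ⟨c, rfl⟩ := exists_eq_sum_of_isHomogeneous_two hf
  have h' : ∀ x : Fin 3 → K, ∑ i, ∑ j, c i j * (x i * x j) = 0 := by
    intro x
    have := h fun i => algebraMap K L (x i)
    rw [aeval_sum_quadratic] at this
    apply (algebraMap K L).injective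
    simpa [map_sum] using this
  have h0 := h' ![1, 0, 0]
  have h1 := h' ![0, 1, 0]
  have h2 := h' ![0, 0, 1]
  have h01 := h' ![1, 1, 0]
  have h02 := h' ![1, 0, 1]
  have h12 := h' ![0, 1, 1]
  simp only [Fin.sum_univ_three, Matrix.cons_val_zero, Matrix.cons_val_one, Matrix.cons_val] at *
  have e0 : c 0 0 = 0 := by linear_combination h0
  have e1 : c 1 1 = 0 := by linear_combination h1
  have e2 : c 2 2 = 0 := by linear_combination h2
  have e01 : c 0 1 = -c 1 0 := by linear_combination h01 - h0 - h1
  have e02 : c 0 2 = -c 2 0 := by linear_combination h02 - h0 - h2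
  have e12 : c 1 2 = -c 2 1 := by linear_combination h12 - h1 - h2
  rw [e0, e1, e2, e01, e02, e12]
  simp only [map_neg, map_zero]
  ring

/-- Homogeneity makes the chosen representative of a line irrelevant. -/
theorem mem_extendedDualConic_iff {f : MvPolynomial (Fin 3) K} (hf : f.IsHomogeneous 2)
    (g : Homography L) (m : Line L) :
    m ∈ extendedDualConic f g ↔ MvPolynomial.aeval (lineCoord g m) f = 0 := by
  obtain ⟨c, rfl⟩ := exists_eq_sum_of_isHomogeneous_two hf
  have hsmul : ∀ (b : L) (x : Fin 3 → L), ∑ i, ∑ j, algebraMap K L (c i j) * ((b • x) i * (b • x) j) =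
      b ^ 2 * ∑ i, ∑ j, algebraMap K L (c i j) * (x i * x j) := fun b x => by
    simp only [Finset.mul_sum, Pi.smul_apply, smul_eq_mul]
    refine Finset.sum_congr rfl fun i _ => Finset.sum_congr rfl fun j _ => ?_
    ring
  constructor
  · rintro ⟨m₀, h, hm⟩
    obtain ⟨b, -, hb'⟩ := (mapsLine_iff_lineCoord g m₀ m).1 hm
    rw [aeval_sum_quadratic] at h ⊢
    rw [hb', hsmul, h, mul_zero]
  · intro h
    obtain ⟨b, hb⟩ := Projectivization.exists_smul_eq_mk_rep L _ (lineCoord_ne_zero g m)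
    rw [aeval_sum_quadratic] at h
    refine ⟨Projectivization.mk L _ (lineCoord_ne_zero g m), ?_,
      (mapsLine_iff_lineCoord g _ m).2 ⟨(b⁻¹ : Lˣ), by simp, ?_⟩⟩
    · rw [aeval_sum_quadratic, ← hb, Units.smul_def, hsmul, h, mul_zero]
    · rw [← hb, ← Units.smul_def, inv_smul_smul]

variable {σ : L →ₐ[K] L}

theorem lineCoord_eq_vec_dotProduct {G g : Homography L} {a : Fin 3 → L}
    (ha : ∀ j, G (vec σ (a j)) = g (Pi.single j 1)) (m : Line L) (j : Fin 3) :
    lineCoord g m j = vec σ (a j) ⬝ᵥ lineCoord G m := by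
  rw [← apply_dotProduct_rep, ha]; rfl

/-- A special dual conic has the equation `Tr (A y₁ y₂) = 0`. -/
theorem IsModel.exists_of_special (hσ : IsCubicFrobenius σ) {G g : Homography L}
    {π : Set (Point L)} {l : Line L} (hG : IsModel σ G π l) {a : Fin 3 → L}
    (ha : ∀ j, G (vec σ (a j)) = g (Pi.single j 1)) {f : MvPolynomial (Fin 3) K}
    (hf : f.IsHomogeneous 2) (hf0 : f ≠ 0) (hfix : fixedLines π l ⊆ extendedDualConic f g) :
    ∃ A, A ≠ 0 ∧ ∀ m, m ∈ extendedDualConic f g ↔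
      A * (lineCoord G m 1 * lineCoord G m 2) + σ A * (lineCoord G m 2 * lineCoord G m 0) +
        σ (σ A) * (lineCoord G m 0 * lineCoord G m 1) = 0 := by
  obtain ⟨c, hc⟩ := exists_eq_sum_of_isHomogeneous_two hf
  let B : (Fin 3 → L) → (Fin 3 → L) → L := fun x y => ∑ i, ∑ j, algebraMap K L (c i j) * (x i * y j)
  let a1 : Fin 3 → L := fun j => σ (a j)
  let a2 : Fin 3 → L := fun j => σ (σ (a j))
  have hB : ∀ x y, σ (B x y) = B (fun i => σ (x i)) (fun i => σ (y i)) := fun x y => by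
    simp [B, map_sum]
  -- The form rewritten in the coordinates of the frame `G`. The square terms vanish because the
  -- coordinate triangle lies in the conic; the mixed coefficients are conjugate because `f` is
  -- defined over `K`.
  have hexp : ∀ m, MvPolynomial.aeval (lineCoord g m) f =
      lineCoord G m 0 ^ 2 * B a a + lineCoord G m 1 ^ 2 * B a1 a1 + lineCoord G m 2 ^ 2 * B a2 a2 +
      (lineCoord G m 1 * lineCoord G m 2) * (B a1 a2 + B a2 a1) +
      (lineCoord G m 2 * lineCoord G m 0) * (B a2 a + B a a2) +
      (lineCoord G m 0 * lineCoord G m 1) * (B a a1 + B a1 a) := fun m => by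
    rw [hc, aeval_sum_quadratic]
    simp only [lineCoord_eq_vec_dotProduct ha, vec_dotProduct, B, a1, a2, Fin.sum_univ_three]
    ring
  have hspec : ∀ i : Fin 3, B (fun j => vec σ (a j) i) (fun j => vec σ (a j) i) = 0 := by
    intro i
    obtain ⟨m, b, hb, hm⟩ := exists_lineCoord_eq G (y := Pi.single i 1) (by simp)
    have := (mem_extendedDualConic_iff hf g m).1 (hfix (hG.mem_fixedLines hσ hb hm))
    rw [hexp, hm] at this
    fin_cases i <;> simpa [hb, a1, a2, vec] using this
  have s0 : B a a = 0 := hspec 0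
  have s1 : B a1 a1 = 0 := hspec 1
  have s2 : B a2 a2 = 0 := hspec 2
  have hA1 : σ (B a1 a2 + B a2 a1) = B a2 a + B a a2 := by
    rw [map_add, hB, hB]
    simp only [a1, a2, hσ.cube]
  have hA2 : σ (B a2 a + B a a2) = B a a1 + B a1 a := by
    rw [map_add, hB, hB]
    simp only [a1, a2, hσ.cube]
  have key : ∀ m, m ∈ extendedDualConic f g ↔
      (B a1 a2 + B a2 a1) * (lineCoord G m 1 * lineCoord G m 2) +
        σ (B a1 a2 + B a2 a1) * (lineCoord G m 2 * lineCoord G m 0) +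
        σ (σ (B a1 a2 + B a2 a1)) * (lineCoord G m 0 * lineCoord G m 1) = 0 := by
    intro m
    rw [mem_extendedDualConic_iff hf, hexp, hA1, hA2, s0, s1, s2]
    constructor <;> intro h <;> linear_combination h
  refine ⟨_, fun hA => hf0 (eq_zero_of_isHomogeneous_two (L := L) hf fun x => ?_), key⟩
  by_cases hx : x = 0
  · rw [hx, hc, aeval_sum_quadratic]
    simp
  · obtain ⟨m, b, hb, hm⟩ := exists_lineCoord_eq g hx
    have := (mem_extendedDualConic_iff hf g m).1 ((key m).2 (by rw [hA]; simp))
    rw [hm, hc, aeval_sum_quadratic] at this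
    rw [hc, aeval_sum_quadratic]
    have hb2 : b ^ 2 ≠ 0 := pow_ne_zero 2 hb
    refine mul_left_cancel₀ hb2 ?_
    rw [mul_zero, ← this]
    simp only [Fin.sum_univ_three, Pi.smul_apply, smul_eq_mul]
    ring

/-- Every equation `Tr (A y₁ y₂) = 0` with `A ≠ 0` defines a special dual conic. -/
theorem IsModel.exists_special (hσ : IsCubicFrobenius σ) {G g : Homography L}
    {π : Set (Point L)} {l : Line L} (hG : IsModel σ G π l) {a : Fin 3 → L}
    (ha : ∀ j, G (vec σ (a j)) = g (Pi.single j 1)) {A : L} (hA : A ≠ 0) :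
    ∃ f : MvPolynomial (Fin 3) K, f.IsHomogeneous 2 ∧ f ≠ 0 ∧
      fixedLines π l ⊆ extendedDualConic f g ∧ ∀ m, m ∈ extendedDualConic f g ↔
      A * (lineCoord G m 1 * lineCoord G m 2) + σ A * (lineCoord G m 2 * lineCoord G m 0) +
        σ (σ A) * (lineCoord G m 0 * lineCoord G m 1) = 0 := by
  -- Coefficients recovering the coordinate `y 0` in `G` from the coordinates in `g`; their
  -- conjugates recover `y 1` and `y 2`.
  obtain ⟨d, hd⟩ : ∃ d : Fin 3 → L, ∑ j, d j • vec σ (a j) = Pi.single 0 1 := by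
    refine ⟨g.symm (G (Pi.single 0 1)), G.injective ?_⟩
    simp only [map_sum, map_smul, ha]
    simp only [← map_smul, ← map_sum]
    rw [← pi_eq_sum_univ', LinearEquiv.apply_symm_apply]
  have hd0 : ∀ y : Fin 3 → L, ∑ j, d j * (vec σ (a j) ⬝ᵥ y) = y 0 := fun y => by
    have := congrArg (· ⬝ᵥ y) hd
    simpa [sum_dotProduct] using this
  have hconj : ∀ (y : Fin 3 → L) j, vec σ (a j) ⬝ᵥ conj σ y = σ (vec σ (a j) ⬝ᵥ y) := fun y j => by
    simp only [vec_dotProduct, conj, map_add, map_mul, hσ.cube, Matrix.cons_val_zero,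
      Matrix.cons_val_one, Matrix.cons_val]
    ring
  have hcc : ∀ y, conj σ (conj σ (conj σ y)) = y := fun y => by
    funext i
    fin_cases i <;> simp [conj, hσ.cube]
  have hd1 : ∀ y : Fin 3 → L, ∑ j, σ (d j) * (vec σ (a j) ⬝ᵥ y) = y 1 := fun y => by
    have := congrArg σ (hd0 (conj σ (conj σ y)))
    simp only [map_sum, map_mul, ← hconj, hcc] at this
    simpa [conj, hσ.cube] using this
  have hd2 : ∀ y : Fin 3 → L, ∑ j, σ (σ (d j)) * (vec σ (a j) ⬝ᵥ y) = y 2 := fun y => by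
    have := congrArg σ (hd1 (conj σ (conj σ y)))
    simp only [map_sum, map_mul, ← hconj, hcc] at this
    simpa [conj, hσ.cube] using this
  -- Substituting these expressions into `Tr (A y₁ y₂)` gives coefficients that are traces, hence
  -- lie in `K`.
  have hK : ∀ i j, ∃ k : K, algebraMap K L k = A * (σ (d i) * σ (σ (d j))) +
      σ A * (σ (σ (d i)) * d j) + σ (σ A) * (d i * σ (d j)) := fun i j => hσ.fixed _ (by
    simp only [map_add, map_mul, hσ.cube]; ring)
  choose c hc using hK
  let f : MvPolynomial (Fin 3) K := ∑ i, ∑ j, MvPolynomial.C (c i j) *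
      (MvPolynomial.X i * MvPolynomial.X j)
  have hf : f.IsHomogeneous 2 := by
    refine MvPolynomial.IsHomogeneous.sum _ _ _ fun i _ => MvPolynomial.IsHomogeneous.sum _ _ _
      fun j _ => ?_
    have := (MvPolynomial.isHomogeneous_C (Fin 3) (c i j)).mul
      ((MvPolynomial.isHomogeneous_X K i).mul (MvPolynomial.isHomogeneous_X K j))
    simpa using this
  have hexp : ∀ m, MvPolynomial.aeval (lineCoord g m) f =
      A * (lineCoord G m 1 * lineCoord G m 2) + σ A * (lineCoord G m 2 * lineCoord G m 0) +
        σ (σ A) * (lineCoord G m 0 * lineCoord G m 1) := fun m => by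
    have h0 := hd0 (lineCoord G m)
    have h1 := hd1 (lineCoord G m)
    have h2 := hd2 (lineCoord G m)
    simp only [← lineCoord_eq_vec_dotProduct ha] at h0 h1 h2
    rw [← h0, ← h1, ← h2, aeval_sum_quadratic]
    simp only [hc, Fin.sum_univ_three]
    ring
  refine ⟨f, hf, ?_, fun m hm => ?_, fun m => by rw [mem_extendedDualConic_iff hf, hexp]⟩
  · intro h0
    obtain ⟨m, b, hb, hm⟩ := exists_lineCoord_eq G (y := ![0, 1, 1]) (by
      intro h; simpa using congrFun h 1)
    have := hexp m
    rw [h0, map_zero, hm] at this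
    simp [hA, hb] at this
  · obtain ⟨h0, h1, h2⟩ := hG.mul_eq_zero_of_mem_fixedLines hσ hm
    rw [mem_extendedDualConic_iff hf, hexp, h0, h1, h2]
    ring

end DualConic

/-! ### Pencil and dual-conic sublines in the model. -/

section Sublines

variable {K L : Type*} [Field K] [Field L] [Algebra K L] {σ : L →ₐ[K] L}

theorem IsModel.pencilSublines_eq (hL : Module.finrank K L = 3) (hσ : IsCubicFrobenius σ)
    {G : Homography L} {π : Set (Point L)} {l : Line L} (hG : IsModel σ G π l) :
    pencilSublines π l = {c | ∃ z, z ≠ 0 ∧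
      c = traceCurve σ G fun u => z * u + σ z * σ u + σ (σ z) * σ (σ u) = 0} := by
  have key : ∀ z (hz : G (vec σ z) ≠ 0),
      trace l {m | m ∈ linesOf π ∧ Projectivization.mk L _ hz ∈ pointsOn m} =
        traceCurve σ G fun u => z * u + σ z * σ u + σ (σ z) * σ (σ u) = 0 := by
    intro z hz
    refine hG.trace_eq hL hσ (D := {m | Projectivization.mk L _ hz ∈ pointsOn m}) ?_
    intro m u c hu hc hm
    rw [Set.mem_ofPred_eq, mk_apply_mem_pointsOn, hm, dotProduct_smul, vec_dotProduct]
    simp [vec, hc]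
  ext X
  constructor
  · rintro ⟨P, hP, rfl⟩
    obtain ⟨z, hz, rfl⟩ := (hG.mem_iff P).1 hP
    refine ⟨z, ?_, key z hz⟩
    rintro rfl
    simp [vec] at hz
  · rintro ⟨z, hz, rfl⟩
    have hGz : G (vec σ z) ≠ 0 := by simpa using vec_ne_zero σ hz
    exact ⟨_, (hG.mem_iff _).2 ⟨z, hGz, rfl⟩, (key z hGz).symm⟩

/-- The condition `Tr (A σ(u) σ²(u)) = 0`. -/
def SpecialConic (σ : L →ₐ[K] L) (A u : L) : Prop :=
  A * (σ u * σ (σ u)) + σ A * (σ (σ u) * u) + σ (σ A) * (u * σ u) = 0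

theorem IsModel.trace_special (hL : Module.finrank K L = 3) (hσ : IsCubicFrobenius σ)
    {G : Homography L} {π : Set (Point L)} {l : Line L} (hG : IsModel σ G π l) {A : L}
    {D : Set (Line L)} (hD : ∀ m, m ∈ D ↔
      A * (lineCoord G m 1 * lineCoord G m 2) + σ A * (lineCoord G m 2 * lineCoord G m 0) +
        σ (σ A) * (lineCoord G m 0 * lineCoord G m 1) = 0) :
    trace l {m | m ∈ linesOf π ∧ m ∈ D} = traceCurve σ G (SpecialConic σ A) := by
  refine hG.trace_eq hL hσ fun m u c hu hc hm => ?_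
  rw [hD, hm]
  simp only [vec, Pi.smul_apply, smul_eq_mul, Matrix.cons_val_zero, Matrix.cons_val_one,
    Matrix.cons_val, SpecialConic]
  have hc2 : c ^ 2 ≠ 0 := pow_ne_zero 2 hc
  constructor
  · intro h
    refine mul_left_cancel₀ hc2 ?_
    linear_combination h
  · intro h
    linear_combination c ^ 2 * h

/-- A dual conic brings its own presentation `g` of `π`, and the frame is built from that `g`. The
frame thus depends on the subline, which is why two subplanes are compared in arbitrary frames. -/
theorem exists_traceCurve_of_mem_dualConicSublines (hL : Module.finrank K L = 3)
    (hσ : IsCubicFrobenius σ) {π : Set (Point L)} {l : Line L} (hext : IsExterior π l)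
    {c : Set (Point L)} (hc : c ∈ dualConicSublines K π l) :
    ∃ G, IsModel σ G π l ∧ ∃ A, A ≠ 0 ∧ c = traceCurve σ G (SpecialConic σ A) := by
  obtain ⟨D, ⟨⟨g, f, rfl, hf, hf0, rfl⟩, hfix⟩, rfl⟩ := hc
  obtain ⟨G, hG, a, ha⟩ := exists_isModel hL hσ hext
  obtain ⟨A, hA, hD⟩ := hG.exists_of_special hσ ha hf hf0 hfix
  exact ⟨G, hG, A, hA, hG.trace_special hL hσ hD⟩

theorem exists_isModel_traceCurve_mem (hL : Module.finrank K L = 3) (hσ : IsCubicFrobenius σ)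
    {π : Set (Point L)} {l : Line L} (hπ : IsSubplane K π) (hext : IsExterior π l) :
    ∃ G, IsModel σ G π l ∧
      ∀ A, A ≠ 0 → traceCurve σ G (SpecialConic σ A) ∈ dualConicSublines K π l := by
  obtain ⟨g, rfl⟩ := hπ
  obtain ⟨G, hG, a, ha⟩ := exists_isModel hL hσ hext
  refine ⟨G, hG, fun A hA => ?_⟩
  obtain ⟨f, hf, hf0, hfix, hD⟩ := hG.exists_special hσ ha hA
  exact ⟨_, ⟨⟨g, f, rfl, hf, hf0, rfl⟩, hfix⟩, (hG.trace_special hL hσ hD).symm⟩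

theorem mk_mem_traceCurve {G : Homography L} {C : L → Prop} {s t : L} (h : G ![0, s, t] ≠ 0) :
    Projectivization.mk L _ h ∈ traceCurve σ G C ↔
      ∃ u, u ≠ 0 ∧ C u ∧ σ u * s + σ (σ u) * t = 0 := by
  constructor
  · rintro ⟨s', t', h', he, u, hu, hC, hst⟩
    obtain ⟨c, hc⟩ := (Projectivization.mk_eq_mk_iff' _ _ _ _ _).1 he
    rw [← map_smul] at hc
    have hc := G.injective hc
    have e1 : c * s' = s := by simpa using congrFun hc 1
    have e2 : c * t' = t := by simpa using congrFun hc 2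
    refine ⟨u, hu, hC, ?_⟩
    rw [← e1, ← e2]
    linear_combination c * hst
  · rintro ⟨u, hu, hC, hst⟩
    exact ⟨s, t, h, rfl, u, hu, hC, hst⟩

theorem IsModel.splash_eq (hL : Module.finrank K L = 3) (hσ : IsCubicFrobenius σ)
    {G : Homography L} {π : Set (Point L)} {l : Line L} (hG : IsModel σ G π l) :
    splash π l = traceCurve σ G fun _ => True := by
  rw [← hG.trace_eq hL hσ (D := Set.univ) (C := fun _ => True) (by simp)]
  simp [splash]

end Sublines

/-! ### Comparison of two subplanes with a common splash and a common subline. -/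

section TwoSubplanes

variable {K L : Type*} [Field K] [Field L] [Algebra K L] {σ : L →ₐ[K] L}

/-- Two frames in which the line `l` is `x = 0` differ by a matrix with first row `(1, 0, 0)`. -/
theorem exists_transition {G₁ G₂ : Homography L} {l : Line L}
    (h₁ : lineCoord G₁ l = ![1, 0, 0]) (h₂ : lineCoord G₂ l = ![1, 0, 0]) :
    ∃ e f α β γ δ : L, α * δ - β * γ ≠ 0 ∧ ∀ x y z, G₁ ![x, y, z] =
      G₂ ![x, e * x + α * y + β * z, f * x + γ * y + δ * z] := by
  let H : Homography L := G₁.trans G₂.symm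
  have hGH : ∀ x, G₂ (H x) = G₁ x := fun x => by simp [H]
  have hd : ∀ x : Fin 3 → L, x ⬝ᵥ ![1, 0, 0] = x 0 := fun x => by
    simp [dotProduct, Fin.sum_univ_three]
  have hH0 : ∀ x, H x 0 = x 0 := fun x => by
    rw [← hd (H x), ← h₂, ← apply_dotProduct_rep, hGH, apply_dotProduct_rep, h₁, hd]
  have hH : ∀ x y z i, H ![x, y, z] i =
      x * H (Pi.single 0 1) i + y * H (Pi.single 1 1) i + z * H (Pi.single 2 1) i := by
    intro x y z i
    conv_lhs => rw [pi_eq_sum_univ' ![x, y, z]]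
    simp [Fin.sum_univ_three]
  refine ⟨H (Pi.single 0 1) 1, H (Pi.single 0 1) 2, H (Pi.single 1 1) 1, H (Pi.single 2 1) 1,
    H (Pi.single 1 1) 2, H (Pi.single 2 1) 2, fun hdet => ?_, fun x y z => ?_⟩
  · have hinj : ∀ y z, y * H (Pi.single 1 1) 1 + z * H (Pi.single 2 1) 1 = 0 →
        y * H (Pi.single 1 1) 2 + z * H (Pi.single 2 1) 2 = 0 → y = 0 ∧ z = 0 := by
      intro y z h1 h2
      have : H ![0, y, z] = 0 := by
        funext i
        fin_cases i
        · simpa using hH0 ![0, y, z]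
        · simpa [h1] using hH 0 y z 1
        · simpa [h2] using hH 0 y z 2
      rw [LinearEquiv.map_eq_zero_iff] at this
      exact ⟨by simpa using congrFun this 1, by simpa using congrFun this 2⟩
    obtain ⟨h1, h2⟩ := hinj (H (Pi.single 2 1) 2) (-H (Pi.single 1 1) 2)
      (by linear_combination hdet) (by ring)
    obtain ⟨h3, h4⟩ := hinj (H (Pi.single 2 1) 1) (-H (Pi.single 1 1) 1)
      (by ring) (by linear_combination -hdet)
    obtain ⟨h5, -⟩ := hinj 1 0 (by linear_combination -h4) (by linear_combination -h2)
    exact one_ne_zero h5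
  · rw [← hGH]
    congr 1
    funext i
    fin_cases i
    · simpa using hH0 ![x, y, z]
    · simp only [Fin.mk_one]
      rw [hH]
      simp only [Matrix.cons_val_one, Matrix.cons_val_zero]
      ring
    · change H ![x, y, z] 2 = _
      rw [hH]
      simp only [Fin.reduceFinMk, Matrix.cons_val]
      ring

/-- Two subplanes with a common subline coincide if a homography between them that fixes the
exterior line also fixes its intersections with the two conjugate lines. -/
theorem eq_of_common_subline [Finite K] (hL : Module.finrank K L = 3) (hσ : IsCubicFrobenius σ)
    {G₁ G₂ : Homography L} {π₁ π₂ b : Set (Point L)} {l : Line L} (h₁ : IsModel σ G₁ π₁ l)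
    (h₂ : IsModel σ G₂ π₂ l) (hb : IsSubline K b) (hb₁ : b ⊆ π₁) (hb₂ : b ⊆ π₂)
    {e f α δ : L} (hα : α ≠ 0)
    (hG : ∀ x y z, G₁ ![x, y, z] = G₂ ![x, e * x + α * y, f * x + δ * z]) : π₁ = π₂ := by
  obtain ⟨g, rfl⟩ := hb
  have hn := fun {x : L} (hx : x ≠ 0) => IsCubicFrobenius.ne_zero σ hx
  -- The `q + 1` points of the canonical subline, with `none` as the point at infinity.
  let w₀ : Option K → (Fin 3 → K) := fun i => i.elim ![0, 1, 0] fun k => ![1, k, 0]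
  let w : Option K → (Fin 3 → L) := fun i j => algebraMap K L (w₀ i j)
  have hw2 : ∀ i, w₀ i 2 = 0 := by rintro (_ | k) <;> simp [w₀]
  have hw0 : ∀ i, w i ≠ 0 := by
    rintro (_ | k) h
    · simpa [w, w₀] using congrFun h 1
    · simpa [w, w₀] using congrFun h 0
  have hgw : ∀ i, g (w i) ≠ 0 := fun i => by simpa using hw0 i
  have hwinj : ∀ i j (c : L), c • w i = w j → i = j := by
    rintro (_ | i) (_ | j) c h
    · rfl
    · simpa [w, w₀] using congrFun h 0
    · have h0 : c = 0 := by simpa [w, w₀] using congrFun h 0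
      simpa [w, w₀, h0] using congrFun h 1
    · have h0 : c = 1 := by simpa [w, w₀] using congrFun h 0
      have h1 : i = j := by simpa [w, w₀, h0] using congrFun h 1
      rw [h1]
  have hbmem : ∀ i, Projectivization.mk L _ (hgw i) ∈ image g (standardSubline K) := fun i =>
    ⟨_, ⟨w₀ i, hw2 i, hw0 i, rfl⟩, smul_mk_eq g (hw0 i)⟩
  -- The line carrying `b`; it is a line of both subplanes, with parameters `u` and `v`.
  obtain ⟨m, c₀, hc₀, hm⟩ := exists_lineCoord_eq g (y := Pi.single 2 1) (by simp)
  have hmw : ∀ i, Projectivization.mk L _ (hgw i) ∈ pointsOn m := fun i => by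
    rw [mk_apply_mem_pointsOn, hm]
    simp [w, hw2]
  have hmline : ∀ π : Set (Point L), image g (standardSubline K) ⊆ π → m ∈ linesOf π := by
    intro π hπ
    refine ⟨_, hπ (hbmem none), _, hπ (hbmem (some 0)), fun h => ?_, hmw _, hmw _⟩
    obtain ⟨c, hc⟩ := (Projectivization.mk_eq_mk_iff' _ _ _ _ _).1 h
    rw [← map_smul] at hc
    have := hwinj _ _ _ (g.injective hc)
    simp at this
  obtain ⟨u, hu, c, hc, hmu⟩ := (h₁.mem_linesOf_iff hL hσ m).1 (hmline π₁ hb₁)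
  obtain ⟨v, hv, c', hc', hmv⟩ := (h₂.mem_linesOf_iff hL hσ m).1 (hmline π₂ hb₂)
  have hu1 := hn hu
  have hu2 := hn hu1
  have hv1 := hn hv
  have hv2 := hn hv1
  have hpt : ∀ {G : Homography L} {π : Set (Point L)} {u c : L}, IsModel σ G π l →
      image g (standardSubline K) ⊆ π → c ≠ 0 → lineCoord G m = c • vec σ u →
      ∀ i, ∃ z c : L, z ≠ 0 ∧ c ≠ 0 ∧ g (w i) = c • G (vec σ z) ∧
        u * z + σ (u * z) + σ (σ (u * z)) = 0 := by
    intro G π u c h hb hc hmu i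
    obtain ⟨z, hz, hi⟩ := (h.mem_iff _).1 (hb (hbmem i))
    obtain ⟨d, hd⟩ := (Projectivization.mk_eq_mk_iff' _ _ _ _ _).1 hi
    have hmi := hmw i
    rw [hi, mk_apply_mem_pointsOn, hmu, dotProduct_smul, vec_dotProduct] at hmi
    refine ⟨z, d, ?_, ?_, hd.symm, ?_⟩
    · rintro rfl
      simp [vec] at hz
    · rintro rfl
      exact hgw i (by rw [← hd, zero_smul])
    · have : z * u + σ z * σ u + σ (σ z) * σ (σ u) = 0 := by simpa [vec, hc] using hmi
      simp only [map_mul]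
      linear_combination this
  choose z d hz hd hzd hzu using hpt h₁ hb₁ hc hmu
  choose z' d' hz' hd' hzd' hzv using hpt h₂ hb₂ hc' hmv
  have hGvec : ∀ z, G₁ (vec σ z) = G₂ ![z, e * z + α * σ z, f * z + δ * σ (σ z)] := fun z => hG _ _ _
  have hzz' : ∀ i, ∃ b : L, b ≠ 0 ∧ z i = b * z' i ∧ e * z i + α * σ (z i) = b * σ (z' i) := by
    intro i
    have h := (hzd i).symm.trans (hzd' i)
    rw [hGvec, ← map_smul, ← map_smul] at h
    have h := G₂.injective h
    have e0 : d i * z i = d' i * z' i := by simpa [vec] using congrFun h 0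
    have e1 : d i * (e * z i + α * σ (z i)) = d' i * σ (z' i) := by simpa [vec] using congrFun h 1
    have hdi := hd i
    refine ⟨d' i / d i, div_ne_zero (hd' i) hdi, ?_, ?_⟩
    · field_simp; linear_combination e0
    · field_simp; linear_combination e1
  -- A point `z` of `m` has `Tr (u z) = 0`, so `r = σ(u z) / (u z)` is a root of `1 + r + r ^ (q +
  -- 1)`. Distinct points of `b` give distinct roots.
  have hroot : ∀ y : L, y ≠ 0 → y + σ y + σ (σ y) = 0 →
      1 + σ y / y + σ y / y * σ (σ y / y) = 0 := by
    intro y hy h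
    have hy1 := hn hy
    rw [map_div₀]
    field_simp
    linear_combination h
  have hinj : Function.Injective fun i => σ (u * z i) / (u * z i) := by
    intro i j hij
    dsimp only at hij
    obtain ⟨k, hk⟩ := hσ.fixed (z j / z i) (by
      have := hn (hz i)
      have := hz i
      have := hz j
      rw [map_mul, map_mul] at hij
      rw [map_div₀]
      field_simp at hij ⊢
      linear_combination -hij)
    have hji : z j = algebraMap K L k * z i := by
      have := hz i
      rw [hk]; field_simp
    refine hwinj i j (d j / d i * algebraMap K L k) (g.injective ?_)
    have := hd i
    rw [map_smul, hzd i, hzd j, hji, vec_smul, map_smul, smul_smul, smul_smul]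
    congr 1
    field_simp
  -- On these ratios the transition is affine, so `eq_id_of_affine` determines `e` and `α`.
  have haff : ∀ i, e * (σ v / v) + α * (u * σ v) / (v * σ u) * (σ (u * z i) / (u * z i)) =
      σ (v * z' i) / (v * z' i) := by
    intro i
    obtain ⟨b, hb, hb0, hb1⟩ := hzz' i
    have := hz i
    have := hz' i
    rw [map_mul, map_mul]
    field_simp
    rw [hb0] at hb1 ⊢
    linear_combination z' i * hb1
  obtain ⟨hE, hA⟩ := hσ.eq_id_of_affine (div_ne_zero (mul_ne_zero hα (mul_ne_zero hu hv1))
    (mul_ne_zero hv hu1)) hinj (fun i => hroot _ (mul_ne_zero hu (hz i)) (hzu i))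
    fun i => (haff i).symm ▸ hroot _ (mul_ne_zero hv (hz' i)) (hzv i)
  have he : e = 0 := by simpa [hv, hv1] using hE
  subst he
  have hA' : α * (u * σ v) = v * σ u := by
    rwa [div_eq_one_iff_eq (mul_ne_zero hv hu1)] at hA
  -- Comparing the equations of `m` in the two frames determines the remaining entries `f` and `δ`;
  -- the transition is then `z ↦ (u / v) z` on the model, up to a scalar.
  have hcoord : ∀ x y z : L, c' * (x * v + (α * y) * σ v + (f * x + δ * z) * σ (σ v)) =
      c * (x * u + y * σ u + z * σ (σ u)) := by
    intro x y z
    have h := apply_dotProduct_rep G₁ m ![x, y, z]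
    rw [hG, apply_dotProduct_rep, hmv, hmu] at h
    rw [dotProduct_smul, dotProduct_smul] at h
    simpa only [vec, dotProduct, Fin.sum_univ_three, smul_eq_mul, Matrix.cons_val_zero,
      Matrix.cons_val_one, Matrix.cons_val, zero_add, zero_mul] using h
  have c1 := hcoord 0 1 0
  have c2 := hcoord 0 0 1
  have c0 := hcoord 1 0 0
  have hcv : c' * v = c * u := by
    refine mul_right_cancel₀ hu1 ?_
    linear_combination u * c1 - c' * hA'
  have hf : f = 0 := by
    have : c' * (f * σ (σ v)) = 0 := by linear_combination c0 - hcv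
    simpa [hc', hv2] using this
  subst hf
  have hδ : δ * (u * σ (σ v)) = v * σ (σ u) := by
    refine mul_left_cancel₀ hc' ?_
    linear_combination u * c2 - σ (σ u) * hcv
  have hvec : ∀ z, G₁ (vec σ z) = (v / u) • G₂ (vec σ (u / v * z)) := by
    intro z
    rw [hGvec, ← map_smul]
    congr 1
    funext i
    fin_cases i
    · simp [vec]; field_simp
    · simp [vec]
      field_simp
      linear_combination σ z * hA'
    · simp [vec]
      field_simp
      linear_combination σ (σ z) * hδ
  have huv : v / u ≠ 0 := div_ne_zero hv hu
  ext P
  rw [h₁.mem_iff, h₂.mem_iff]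
  constructor
  · rintro ⟨z, hz, rfl⟩
    have h := hz
    rw [hvec] at h
    refine ⟨u / v * z, right_ne_zero_of_smul h, ?_⟩
    rw [Projectivization.mk_eq_mk_iff']
    exact ⟨v / u, (hvec z).symm⟩
  · rintro ⟨z, hz, rfl⟩
    have e : z = u / v * (v / u * z) := by field_simp
    have h := hvec (v / u * z)
    rw [← e] at h
    refine ⟨v / u * z, by rw [h]; exact smul_ne_zero huv hz, ?_⟩
    rw [eq_comm, Projectivization.mk_eq_mk_iff']
    exact ⟨v / u, h.symm⟩

/-- For two exterior subplanes with a common splash and a common subline, the pencils of the first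
cut out the same sublines as the special dual conics of the second. -/
theorem exists_traceCurve_eq [Finite K] (hL : Module.finrank K L = 3) (hσ : IsCubicFrobenius σ)
    {G₁ G₂ : Homography L} {π₁ π₂ b : Set (Point L)} {l : Line L} (h₁ : IsModel σ G₁ π₁ l)
    (h₂ : IsModel σ G₂ π₂ l) (hne : π₁ ≠ π₂) (hS : splash π₁ l = splash π₂ l)
    (hb : IsSubline K b) (hb₁ : b ⊆ π₁) (hb₂ : b ⊆ π₂) :
    ∃ v, v ≠ 0 ∧ ∀ z, traceCurve σ G₁ (fun u => z * u + σ z * σ u + σ (σ z) * σ (σ u) = 0) =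
      traceCurve σ G₂ (SpecialConic σ (v * z)) := by
  obtain ⟨e, f, α, β, γ, δ, hdet, hG⟩ := exists_transition h₁.lineCoord_eq h₂.lineCoord_eq
  have hn := fun {x : L} (hx : x ≠ 0) => IsCubicFrobenius.ne_zero σ hx
  -- A splash point `(0, 1, -n)` becomes `(0, p, r)` in the second frame; lying on a line of `π₂`
  -- forces `N p = -N r`.
  have hnorm : ∀ n, n * σ n * σ (σ n) = 1 →
      (α - β * n) * σ (α - β * n) * σ (σ (α - β * n)) +
        (γ - δ * n) * σ (γ - δ * n) * σ (σ (γ - δ * n)) = 0 := by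
    intro n hnn
    obtain ⟨u, hu, hun⟩ := hσ.exists_of_norm_eq_one hnn
    have h0 : G₁ ![0, 1, -n] ≠ 0 := by
      rw [Ne, LinearEquiv.map_eq_zero_iff]
      intro h
      simpa using congrFun h 1
    have hmem : Projectivization.mk L _ h0 ∈ splash π₁ l := by
      rw [h₁.splash_eq hL hσ, mk_mem_traceCurve]
      exact ⟨u, hu, trivial, by linear_combination -hun⟩
    rw [hS, h₂.splash_eq hL hσ] at hmem
    have hG' : G₁ ![0, 1, -n] = G₂ ![0, α - β * n, γ - δ * n] := by
      rw [hG, show e * 0 + α * 1 + β * -n = α - β * n by ring,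
        show f * 0 + γ * 1 + δ * -n = γ - δ * n by ring]
    simp only [hG'] at hmem
    obtain ⟨w, hw, -, hwst⟩ := (mk_mem_traceCurve _).1 hmem
    have hw1 := hn hw
    have hw2 := hn hw1
    have e1 := congrArg σ hwst
    have e2 := congrArg σ e1
    simp only [map_add, map_mul, hσ.cube, map_zero] at e1 e2
    generalize α - β * n = p at *
    generalize γ - δ * n = r at *
    refine mul_left_cancel₀ (mul_ne_zero (mul_ne_zero hw hw1) hw2) ?_
    have a0 : σ w * p = -(σ (σ w) * r) := by linear_combination hwst
    have a1 : σ (σ w) * σ p = -(w * σ r) := by linear_combination e1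
    have a2 : w * σ (σ p) = -(σ w * σ (σ r)) := by linear_combination e2
    have := congrArg₂ (· * ·) (congrArg₂ (· * ·) a0 a1) a2
    linear_combination this
  rcases hσ.diagonal_or_antidiagonal hL hdet hnorm with ⟨rfl, rfl⟩ | ⟨rfl, rfl⟩
  · refine absurd (eq_of_common_subline hL hσ h₁ h₂ hb hb₁ hb₂ (e := e) (f := f) (α := α) (δ := δ)
      (by rintro rfl; simp at hdet) fun x y z => ?_) hne
    rw [hG]
    simp
  have hβ : β ≠ 0 := by rintro rfl; simp at hdet
  have hγ : γ ≠ 0 := by rintro rfl; simp at hdet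
  have hG0 : ∀ s t, G₁ ![0, s, t] = G₂ ![0, β * t, γ * s] := fun s t => by
    rw [hG]; simp
  have h1 := hnorm 1 (by simp)
  simp only [mul_one, zero_sub, sub_zero, map_neg] at h1
  have hβ1 := hn hβ
  have hβ2 := hn hβ1
  -- Preservation of the splash at `n = 1` says `N γ = N β`. The resulting `v` makes `u ↦ v / u`
  -- compatible with the incidences on `l`.
  obtain ⟨v, hv, hvβ⟩ := hσ.exists_of_norm_eq_one (n := γ / β) (by
    simp only [map_div₀]
    field_simp
    linear_combination h1)
  have hv1 := hn hv
  have hv2 := hn hv1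
  have hvβ' : γ * σ (σ v) = β * σ v := by
    field_simp at hvβ
    exact hvβ
  have key : ∀ z s t : L, (∃ u, u ≠ 0 ∧ z * u + σ z * σ u + σ (σ z) * σ (σ u) = 0 ∧
      σ u * s + σ (σ u) * t = 0) ↔
      ∃ u, u ≠ 0 ∧ SpecialConic σ (v * z) u ∧ σ u * (β * t) + σ (σ u) * (γ * s) = 0 := by
    -- With `v = u w`, multiplying `Tr (z u)` by `N w` gives `Tr (v z σ(w) σ²(w))`.
    have aux : ∀ z s t u w : L, u ≠ 0 → w ≠ 0 → v = u * w →
        ((z * u + σ z * σ u + σ (σ z) * σ (σ u) = 0 ∧ σ u * s + σ (σ u) * t = 0) ↔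
          (SpecialConic σ (v * z) w ∧ σ w * (β * t) + σ (σ w) * (γ * s) = 0)) := by
      rintro z s t u w hu hw rfl
      have hu1 := hn hu
      have hu2 := hn hu1
      have hw1 := hn hw
      have hw2 := hn hw1
      simp only [map_mul] at hvβ'
      refine and_congr ?_ ?_
      · simp only [SpecialConic, map_mul]
        constructor
        · intro h
          linear_combination w * σ w * σ (σ w) * h
        · intro h
          refine mul_left_cancel₀ (mul_ne_zero (mul_ne_zero hw hw1) hw2) ?_
          linear_combination h
      · constructor
        · intro h
          refine mul_left_cancel₀ hu2 ?_
          linear_combination β * σ w * h + s * hvβ'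
        · intro h
          refine mul_left_cancel₀ (mul_ne_zero hβ hw1) ?_
          linear_combination σ (σ u) * h - s * hvβ'
    intro z s t
    constructor
    · rintro ⟨u, hu, h⟩
      exact ⟨v / u, div_ne_zero hv hu,
        (aux z s t u (v / u) hu (div_ne_zero hv hu) (by field_simp)).1 h⟩
    · rintro ⟨w, hw, h⟩
      exact ⟨v / w, div_ne_zero hv hw,
        (aux z s t (v / w) w (div_ne_zero hv hw) hw (by field_simp)).2 h⟩
  refine ⟨v, hv, fun z => Set.ext fun X => ⟨?_, ?_⟩⟩
  · rintro ⟨s, t, h, rfl, hu⟩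
    simp only [hG0] at h ⊢
    exact (mk_mem_traceCurve h).2 ((key z s t).1 hu)
  · rintro ⟨s, t, h, rfl, hu⟩
    have e1 : s = β * (s / β) := by field_simp
    have e2 : t = γ * (t / γ) := by field_simp
    rw [e1, e2] at hu
    have hst : G₂ ![0, s, t] = G₁ ![0, t / γ, s / β] := by rw [hG0, ← e1, ← e2]
    simp only [hst] at h ⊢
    exact (mk_mem_traceCurve h).2 ((key z _ _).2 hu)

/-- Multiplication by `v` permutes the nonzero elements of `L`, so pencils and special dual conics
correspond bijectively, whatever frame the conic requires. -/
theorem pencilSublines_eq_dualConicSublines [Finite K] (hL : Module.finrank K L = 3)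
    {π₁ π₂ b : Set (Point L)} {l : Line L} (hπ₁ : IsSubplane K π₁) (hπ₂ : IsSubplane K π₂)
    (hne : π₁ ≠ π₂) (hext₁ : IsExterior π₁ l) (hext₂ : IsExterior π₂ l)
    (hS : splash π₁ l = splash π₂ l) (hb : IsSubline K b) (hb₁ : b ⊆ π₁) (hb₂ : b ⊆ π₂) :
    pencilSublines π₁ l = dualConicSublines K π₂ l := by
  obtain ⟨σ, hσ⟩ := exists_isCubicFrobenius hL
  obtain ⟨G₁, h₁, -⟩ := exists_isModel_traceCurve_mem hL hσ hπ₁ hext₁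
  rw [h₁.pencilSublines_eq hL hσ]
  ext X
  constructor
  · rintro ⟨z, hz, rfl⟩
    obtain ⟨G₂, h₂, hmem⟩ := exists_isModel_traceCurve_mem hL hσ hπ₂ hext₂
    obtain ⟨v, hv, h⟩ := exists_traceCurve_eq hL hσ h₁ h₂ hne hS hb hb₁ hb₂
    rw [h]
    exact hmem _ (mul_ne_zero hv hz)
  · intro hX
    obtain ⟨G₂, h₂, A, hA, rfl⟩ := exists_traceCurve_of_mem_dualConicSublines hL hσ hext₂ hX
    obtain ⟨v, hv, h⟩ := exists_traceCurve_eq hL hσ h₁ h₂ hne hS hb hb₁ hb₂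
    refine ⟨A / v, div_ne_zero hA hv, ?_⟩
    rw [h, mul_div_cancel₀ _ hv]

end TwoSubplanes

end ExteriorSplash

theorem theorem4p1 {K L : Type*} [Field K] [Finite K] [Field L] [Algebra K L]
    (hKL : Module.finrank K L = 3)
    (linf : ExteriorSplash.Line L)
    (π₁ π₂ S b : Set (ExteriorSplash.Point L))
    (hπ₁ : ExteriorSplash.IsSubplane K π₁) (hπ₂ : ExteriorSplash.IsSubplane K π₂)
    (hne : π₁ ≠ π₂)
    (hext₁ : ExteriorSplash.IsExterior π₁ linf) (hext₂ : ExteriorSplash.IsExterior π₂ linf)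
    (hS₁ : ExteriorSplash.splash π₁ linf = S) (hS₂ : ExteriorSplash.splash π₂ linf = S)
    (hb : ExteriorSplash.IsSubline K b) (hb₁ : b ⊆ π₁) (hb₂ : b ⊆ π₂) :
    ExteriorSplash.pencilSublines π₁ linf = ExteriorSplash.dualConicSublines K π₂ linf ∧
      ExteriorSplash.dualConicSublines K π₁ linf = ExteriorSplash.pencilSublines π₂ linf :=
  ⟨ExteriorSplash.pencilSublines_eq_dualConicSublines hKL hπ₁ hπ₂ hne hext₁ hext₂
      (hS₁.trans hS₂.symm) hb hb₁ hb₂,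
    (ExteriorSplash.pencilSublines_eq_dualConicSublines hKL hπ₂ hπ₁ hne.symm hext₂ hext₁
      (hS₂.trans hS₁.symm) hb hb₂ hb₁).symm⟩
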